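/- For $T,r>0$ and a function $w:[0,T]\to\mathbb R$ let \[ I_w(T,r):=\inf\Big\{\Big(\int_0^T h'(t)^2\,dt\Big)^{1/2} : h\in AC[0,T],\ \sup_{0\le t\le T}|h(t)-w(t)|\le r,\ h(0)=0\Big\}, \] and let $I^0_w(T,r)$ be the infimum of the same quantity over those $h$ that satisfy in addition $h(T)=w(T)$; here $AC[0,T]$ denotes the absolutely continuous functions on $[0,T]$, and the infima are taken in $[0,\infty]$. There is a constant $C\in[0,\infty)$ such that for every Wiener process $W=(W(t))_{t\ge 0}$ (a standard real Brownian motion started at zero, with almost surely continuous paths) the following holds. For all $T,r>0$ the quantities $I_W(T,r)$ and $I^0_W(T,r)$ are random variables (measurable up to modification on a null set) with finite second moments, and \[ \frac{r^2}{T}\,\mathbb E\, I_W(T,r)^2\to C^2 \qquad\text{and}\qquad \frac{r^2}{T}\,\mathbb E\, I^0_W(T,r)^2\to C^2 \qquad\text{as } \frac{r}{\sqrt T}\to 0, \] where $T,r>0$ may both vary. -/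

import Mathlib

open MeasureTheory ProbabilityTheory Filter Topology Set
open scoped ENNReal NNReal

namespace TautString

/-- The norm `|h|_T = (∫₀ᵀ h'(t)² dt)^{1/2}`, with values in `[0, ∞]`. It is only used for
functions `h` that are absolutely continuous on `[0, T]`, whose derivative exists almost
everywhere on `[0, T]`. -/
noncomputable def sobolevNorm (T : ℝ) (h : ℝ → ℝ) : ℝ≥0∞ :=
  (∫⁻ t in Icc 0 T, ENNReal.ofReal (deriv h t ^ 2)) ^ (1 / 2 : ℝ)

/-- The absolutely continuous functions on `[0, T]` that start at zero and stay within uniform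
distance `r` of `w` on `[0, T]`. -/
def admissible (w : ℝ → ℝ) (T r : ℝ) : Set (ℝ → ℝ) :=
  {h | AbsolutelyContinuousOnInterval h 0 T ∧ (∀ t ∈ Icc 0 T, |h t - w t| ≤ r) ∧ h 0 = 0}

/-- The admissible functions with fixed end `h(T) = w(T)`. -/
def admissibleFixedEnd (w : ℝ → ℝ) (T r : ℝ) : Set (ℝ → ℝ) :=
  {h | h ∈ admissible w T r ∧ h T = w T}

/-- `I_w(T, r)`: the infimum of `|h|_T` over the admissible functions. -/
noncomputable def I (w : ℝ → ℝ) (T r : ℝ) : ℝ≥0∞ :=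
  ⨅ h ∈ admissible w T r, sobolevNorm T h

/-- `I⁰_w(T, r)`: the infimum of `|h|_T` over the admissible functions with fixed end. -/
noncomputable def IFixedEnd (w : ℝ → ℝ) (T r : ℝ) : ℝ≥0∞ :=
  ⨅ h ∈ admissibleFixedEnd w T r, sobolevNorm T h

/-- The trajectory of a process indexed by `[0, ∞)`, as a function on `ℝ` (only its values at
`t ≥ 0` are ever used). -/
def path {Ω : Type*} (W : ℝ≥0 → Ω → ℝ) (ω : Ω) : ℝ → ℝ :=
  fun t => W t.toNNReal ω

/-- The second moment `D(T, r) = E I_W(T, r)²`. -/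
noncomputable def D {Ω : Type*} [MeasurableSpace Ω] (P : Measure Ω) (W : ℝ≥0 → Ω → ℝ)
    (T r : ℝ) : ℝ≥0∞ :=
  ∫⁻ ω, I (path W ω) T r ^ 2 ∂P

/-- The second moment `D⁰(T, r) = E I⁰_W(T, r)²`. -/
noncomputable def DFixedEnd {Ω : Type*} [MeasurableSpace Ω] (P : Measure Ω)
    (W : ℝ≥0 → Ω → ℝ) (T r : ℝ) : ℝ≥0∞ :=
  ∫⁻ ω, IFixedEnd (path W ω) T r ^ 2 ∂P

/-- The regime `r / √T → 0`, over all pairs `(T, r)` with `T > 0` and `r > 0`. -/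
noncomputable def ratioToZero : Filter (ℝ × ℝ) :=
  comap (fun p : ℝ × ℝ => p.2 / √p.1) (𝓝 0) ⊓ 𝓟 {p : ℝ × ℝ | 0 < p.1 ∧ 0 < p.2}

end TautString

/-! Squaring turns both infima into minimal energies, `minEnergy b`, where the proposition `b` says
whether the end is fixed. With fixed end, competitors on successive time intervals can be
concatenated (`minEnergy_add_le`). Increments of Brownian motion after a fixed time are again
Brownian, so the expected energy `E(τ)` on `[0, τ]` at radius 1 is subadditive. By Fekete's lemma
`E(τ)/τ` converges along the integers, and then along the reals because `E` is bounded on `[1, 2]`.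

A free end costs at most as much as a fixed one. Conversely, a free-end competitor is steered back
to the path during one extra unit of time, with radius `1 + δ` and a bounded extra expected cost.
Brownian scaling trades the larger radius for a factor `(1 + δ)²`, and `δ → 0`. Scaling also reduces
`(T, r)` to `τ = T / r²` and radius 1, so the limit is `C²`.

Two points need separate work. Measurability and independence of the chosen Brownian motion follow
from `minEnergy_eq_iSup`: on continuous paths started at zero the minimal energy is a countable
supremum of measurable functionals of countably many samples. Finiteness of the mean follows by
interpolating on the coarsest dyadic grid that a Hölder-type bound makes fine enough, with the
Hölder constant controlled by eighth moments of increments. -/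

namespace TautString

/-! ### Absolute continuity, concatenation and energy -/

/-- Precomposition with a monotone Lipschitz function preserves absolute continuity. -/
theorem _root_.AbsolutelyContinuousOnInterval.comp_monotone {f φ : ℝ → ℝ} {a b c d : ℝ} {K : ℝ≥0}
    (hf : AbsolutelyContinuousOnInterval f a b) (hφ : Monotone φ) (hK : LipschitzWith K φ)
    (hm : MapsTo φ (uIcc c d) (uIcc a b)) :
    AbsolutelyContinuousOnInterval (fun x => f (φ x)) c d := by
  rw [absolutelyContinuousOnInterval_iff] at hf ⊢
  intro ε hε
  obtain ⟨δ, hδ, h⟩ := hf ε hε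
  -- The summand 1 keeps the denominator positive when `K = 0`.
  refine ⟨δ / (K + 1), by positivity, fun E hE hs => ?_⟩
  refine h (E.1, fun i => (φ (E.2 i).1, φ (E.2 i).2)) ⟨fun i hi => ?_, fun i hi j hj hij => ?_⟩ ?_
  · exact ⟨hm (hE.1 i hi).1, hm (hE.1 i hi).2⟩
  · have hd := hE.2 hi hj hij
    simp only [Function.onFun, uIoc] at hd ⊢
    rw [Ioc_disjoint_Ioc] at hd ⊢
    simp only [← hφ.map_min, ← hφ.map_max]
    exact hφ hd
  · calc ∑ i ∈ Finset.range E.1, dist (φ (E.2 i).1) (φ (E.2 i).2)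
        ≤ ∑ i ∈ Finset.range E.1, (K + 1) * dist (E.2 i).1 (E.2 i).2 := by
          refine Finset.sum_le_sum fun i _ => (hK.dist_le_mul _ _).trans ?_
          gcongr
          linarith
      _ < δ := by
          rw [← Finset.mul_sum, mul_comm]
          rwa [lt_div_iff₀ (by positivity)] at hs

theorem _root_.AbsolutelyContinuousOnInterval.congr {f g : ℝ → ℝ} {a b : ℝ}
    (hf : AbsolutelyContinuousOnInterval f a b) (h : EqOn f g (uIcc a b)) :
    AbsolutelyContinuousOnInterval g a b := by
  rw [absolutelyContinuousOnInterval_iff] at hf ⊢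
  intro ε hε
  obtain ⟨δ, hδ, H⟩ := hf ε hε
  refine ⟨δ, hδ, fun E hE hs => ?_⟩
  convert H E hE hs using 1
  refine Finset.sum_congr rfl fun i hi => ?_
  rw [h (hE.1 i hi).1, h (hE.1 i hi).2]

/-- The concatenation of two functions at the point `b`. -/
noncomputable def glue (b : ℝ) (f g : ℝ → ℝ) : ℝ → ℝ := fun t => if t ≤ b then f t else g t

theorem glue_of_le {b t : ℝ} (f g : ℝ → ℝ) (h : t ≤ b) : glue b f g t = f t := if_pos h

theorem glue_of_ge {b t : ℝ} {f g : ℝ → ℝ} (hfg : f b = g b) (h : b ≤ t) : glue b f g t = g t := by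
  rcases h.eq_or_lt with rfl | h
  · simp [glue, hfg]
  · simp [glue, not_le.2 h]

/-- The concatenation equals `f (min x b) + g (max x b) - f b`, and truncations are monotone and
Lipschitz. -/
theorem absolutelyContinuousOnInterval_glue {f g : ℝ → ℝ} {a b c : ℝ} (hab : a ≤ b) (hbc : b ≤ c)
    (hf : AbsolutelyContinuousOnInterval f a b) (hg : AbsolutelyContinuousOnInterval g b c)
    (hfg : f b = g b) : AbsolutelyContinuousOnInterval (glue b f g) a c := by
  have h1 : AbsolutelyContinuousOnInterval (fun x => f (min x b)) a c := by
    refine hf.comp_monotone (φ := fun x => min x b) (K := 1) (fun x y h => min_le_min_right _ h)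
      (LipschitzWith.id.min_const b) fun x hx => ?_
    rw [uIcc_of_le (hab.trans hbc)] at hx
    rw [uIcc_of_le hab]
    exact ⟨le_min hx.1 hab, min_le_right _ _⟩
  have h2 : AbsolutelyContinuousOnInterval (fun x => g (max x b)) a c := by
    refine hg.comp_monotone (φ := fun x => max x b) (K := 1) (fun x y h => max_le_max_right _ h)
      (LipschitzWith.id.max_const b) fun x hx => ?_
    rw [uIcc_of_le (hab.trans hbc)] at hx
    rw [uIcc_of_le hbc]
    exact ⟨le_max_right _ _, max_le hx.2 hbc⟩
  have h3 : AbsolutelyContinuousOnInterval (fun _ : ℝ => f b) a c :=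
    (LipschitzWith.const (f b)).lipschitzOnWith.absolutelyContinuousOnInterval
  refine ((h1.add h2).sub h3).congr fun x _ => ?_
  rcases le_total x b with h | h
  · simp [glue_of_le f g h, h, hfg]
  · simp [glue_of_ge hfg h, h]

/-- The energy `∫ₐᵇ h'(t)² dt`. -/
noncomputable def energy (a b : ℝ) (h : ℝ → ℝ) : ℝ≥0∞ :=
  ∫⁻ t in Icc a b, ENNReal.ofReal (deriv h t ^ 2)

/-- Equality on the open interval is enough: the derivative at an endpoint may see values outside,
but endpoints are null. This makes energies of concatenations add up. -/
theorem energy_congr {f g : ℝ → ℝ} {a b : ℝ} (h : EqOn f g (Ioo a b)) :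
    energy a b f = energy a b g := by
  unfold energy
  rw [← setLIntegral_congr Ioo_ae_eq_Icc, ← setLIntegral_congr Ioo_ae_eq_Icc]
  refine setLIntegral_congr_fun measurableSet_Ioo fun t ht => ?_
  rw [(h.eventuallyEq_of_mem (Ioo_mem_nhds ht.1 ht.2)).deriv_eq]

theorem energy_add {a b c : ℝ} (hab : a ≤ b) (hbc : b ≤ c) (f : ℝ → ℝ) :
    energy a c f = energy a b f + energy b c f := by
  unfold energy
  rw [← Icc_union_Ioc_eq_Icc hab hbc, lintegral_union measurableSet_Ioc,
    setLIntegral_congr Ioc_ae_eq_Icc]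
  exact disjoint_left.2 fun x h1 h2 => h2.1.not_ge h1.2

theorem energy_glue {f g : ℝ → ℝ} {a b c : ℝ} (hab : a ≤ b) (hbc : b ≤ c) (hfg : f b = g b) :
    energy a c (glue b f g) = energy a b f + energy b c g := by
  rw [energy_add hab hbc, energy_congr (g := f) fun t ht => glue_of_le f g ht.2.le,
    energy_congr (g := g) fun t ht => glue_of_ge hfg ht.1.le]

theorem energy_const_mul (c : ℝ) (f : ℝ → ℝ) (a b : ℝ) :
    energy a b (fun t => c * f t) = ENNReal.ofReal (c ^ 2) * energy a b f := by
  unfold energy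
  rw [← lintegral_const_mul' _ _ ENNReal.ofReal_ne_top]
  refine lintegral_congr fun t => ?_
  rw [deriv_const_mul_field', mul_pow, ENNReal.ofReal_mul (sq_nonneg _)]

theorem energy_add_const (f : ℝ → ℝ) (a b c : ℝ) :
    energy a b (fun t => f t + c) = energy a b f := by
  simp [energy]

/-- The energy under an affine change of time. -/
theorem energy_comp_mul_add {c : ℝ} (hc : 0 < c) (d : ℝ) (f : ℝ → ℝ) (a b : ℝ) :
    energy a b (fun t => f (c * t + d)) = ENNReal.ofReal c * energy (c * a + d) (c * b + d) f := by
  have hmap : Measure.map (fun t : ℝ => c * t + d) volume = ENNReal.ofReal c⁻¹ • volume := by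
    have h1 : (fun t : ℝ => c * t + d) = (fun t => t + d) ∘ (fun t => c * t) := rfl
    rw [h1, ← Measure.map_map (by fun_prop) (by fun_prop), Real.map_volume_mul_left hc.ne',
      Measure.map_smul, map_add_right_eq_self, abs_of_pos (inv_pos.2 hc)]
  have hemb : MeasurableEmbedding (fun t : ℝ => c * t + d) :=
    (measurableEmbedding_addRight d).comp (measurableEmbedding_mulLeft₀ hc.ne')
  have hpre : (fun t : ℝ => c * t + d) ⁻¹' Icc (c * a + d) (c * b + d) = Icc a b := by
    ext t
    simp [hc]
  have hder : ∀ t, deriv (fun t => f (c * t + d)) t = c * deriv f (c * t + d) := by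
    intro t
    have := deriv_comp_mul_left c (fun s => f (s + d)) t
    rw [this, deriv_comp_add_const, smul_eq_mul]
  unfold energy
  have key := hemb.lintegral_map (μ := volume)
    (fun s => (Icc (c * a + d) (c * b + d)).indicator (fun s => ENNReal.ofReal (deriv f s ^ 2)) s)
  rw [hmap, lintegral_smul_measure, lintegral_indicator measurableSet_Icc] at key
  have key2 : ∫⁻ t in Icc a b, ENNReal.ofReal (deriv f (c * t + d) ^ 2) =
      ENNReal.ofReal c⁻¹ * ∫⁻ t in Icc (c * a + d) (c * b + d), ENNReal.ofReal (deriv f t ^ 2) := by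
    rw [← smul_eq_mul, key, ← lintegral_indicator measurableSet_Icc]
    refine lintegral_congr fun t => ?_
    rw [← hpre]
    rfl
  simp_rw [hder, mul_pow, ENNReal.ofReal_mul (sq_nonneg c)]
  rw [lintegral_const_mul' _ _ ENNReal.ofReal_ne_top, key2, ← mul_assoc,
    ← ENNReal.ofReal_mul (sq_nonneg c)]
  congr 2
  field_simp

/-! ### Energy bounds from increments, piecewise linear functions -/

/-- Cauchy–Schwarz: the increment of an absolutely continuous function is controlled by its
energy. -/
theorem ofReal_sq_sub_div_le_energy {h : ℝ → ℝ} {a b : ℝ} (hab : a < b)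
    (hh : AbsolutelyContinuousOnInterval h a b) :
    ENNReal.ofReal ((h b - h a) ^ 2 / (b - a)) ≤ energy a b h := by
  by_cases htop : energy a b h = ∞
  · simp [htop]
  have hint := hh.intervalIntegrable_deriv
  rw [intervalIntegrable_iff_integrableOn_Icc_of_le hab.le] at hint
  have hsq : IntegrableOn (fun t => deriv h t ^ 2) (Icc a b) := by
    refine ⟨hint.1.pow 2, ?_⟩
    rw [hasFiniteIntegral_iff_ofReal (Eventually.of_forall fun t => sq_nonneg _)]
    exact lt_top_iff_ne_top.2 htop
  have hE : energy a b h = ENNReal.ofReal (∫ t in Icc a b, deriv h t ^ 2) :=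
    (ofReal_integral_eq_lintegral_ofReal hsq (Eventually.of_forall fun t => sq_nonneg _)).symm
  have hI : ∫ t in Icc a b, deriv h t = h b - h a := by
    rw [← hh.integral_deriv_eq_sub, intervalIntegral.integral_of_le hab.le,
      integral_Icc_eq_integral_Ioc]
  rw [hE]
  refine ENNReal.ofReal_le_ofReal ?_
  -- `m` is the mean slope; the bound is the expansion of `0 ≤ ∫ (h' - m)²`.
  set m := (h b - h a) / (b - a) with hm
  have hba : 0 < b - a := sub_pos.2 hab
  have h0 : 0 ≤ ∫ t in Icc a b, (deriv h t - m) ^ 2 := integral_nonneg fun t => sq_nonneg _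
  have h1 : ∫ t in Icc a b, (deriv h t - m) ^ 2 =
      (∫ t in Icc a b, deriv h t ^ 2) - 2 * m * (h b - h a) + m ^ 2 * (b - a) := by
    have h2 : (fun t => (deriv h t - m) ^ 2) =
        fun t => deriv h t ^ 2 - 2 * m * deriv h t + m ^ 2 := by
      ext t; ring
    have hc : IntegrableOn (fun _ : ℝ => m ^ 2) (Icc a b) := by
      simp
    have hs : IntegrableOn (fun t => deriv h t ^ 2 - 2 * m * deriv h t) (Icc a b) :=
      hsq.sub (hint.const_mul _)
    rw [h2, integral_add hs hc, integral_sub hsq (hint.const_mul _),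
      integral_const_mul, hI]
    simp [hab.le, mul_comm]
  have h3 : (h b - h a) ^ 2 / (b - a) = 2 * m * (h b - h a) - m ^ 2 * (b - a) := by
    rw [hm]; field_simp; ring
  linarith

theorem sum_ofReal_sq_sub_div_le_energy {h : ℝ → ℝ} {δ : ℝ} (hδ : 0 < δ) (n : ℕ)
    (hh : AbsolutelyContinuousOnInterval h 0 (n * δ)) :
    ENNReal.ofReal ((∑ k ∈ Finset.range n, (h ((k + 1 : ℕ) * δ) - h (k * δ)) ^ 2) / δ) ≤
      energy 0 (n * δ) h := by
  induction n with
  | zero => simp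
  | succ n ih =>
    have hn : (0 : ℝ) ≤ n * δ := by positivity
    have hn1 : (n : ℝ) * δ ≤ (n + 1 : ℕ) * δ := by push_cast; nlinarith
    rw [Finset.sum_range_succ, add_div, ENNReal.ofReal_add (by positivity) (by positivity),
      energy_add hn hn1]
    refine add_le_add (ih (hh.mono ?_)) ?_
    · rw [uIcc_of_le hn, uIcc_of_le (hn.trans hn1)]
      exact Icc_subset_Icc_right hn1
    · have := ofReal_sq_sub_div_le_energy (h := h) (a := n * δ) (b := (n + 1 : ℕ) * δ)
        (by push_cast; nlinarith) (hh.mono ?_)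
      · rwa [show ((n + 1 : ℕ) : ℝ) * δ - n * δ = δ by push_cast; ring] at this
      · rw [uIcc_of_le hn1, uIcc_of_le (hn.trans hn1)]
        exact Icc_subset_Icc_left hn

theorem absolutelyContinuousOnInterval_affine (p q a b : ℝ) :
    AbsolutelyContinuousOnInterval (fun t => p * t + q) a b :=
  (ContDiff.contDiffOn (by fun_prop)).absolutelyContinuousOnInterval

theorem energy_affine (p q : ℝ) {a b : ℝ} :
    energy a b (fun t => p * t + q) = ENNReal.ofReal (p ^ 2) * ENNReal.ofReal (b - a) := by
  have : ∀ t : ℝ, deriv (fun t => p * t + q) t = p := fun t => by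
    simp
  simp [energy, this]

/-- Piecewise linear interpolation on a uniform grid. -/
theorem exists_interpolation {δ : ℝ} (hδ : 0 < δ) (n : ℕ) (x : ℕ → ℝ) :
    ∃ h : ℝ → ℝ, AbsolutelyContinuousOnInterval h 0 (n * δ) ∧ (∀ k ≤ n, h (k * δ) = x k) ∧
      (∀ k < n, ∀ t ∈ Icc (k * δ) ((k + 1 : ℕ) * δ), h t ∈ uIcc (x k) (x (k + 1))) ∧
      energy 0 (n * δ) h =
        ENNReal.ofReal ((∑ k ∈ Finset.range n, (x (k + 1) - x k) ^ 2) / δ) := by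
  induction n with
  | zero =>
    refine ⟨fun _ => x 0, (LipschitzWith.const (x 0)).lipschitzOnWith.absolutelyContinuousOnInterval,
      by simp, by simp, by simp [energy]⟩
  | succ n ih =>
    obtain ⟨h, hac, hx, hu, he⟩ := ih
    have hn : (0 : ℝ) ≤ n * δ := by positivity
    have hn1 : (n : ℝ) * δ ≤ (n + 1 : ℕ) * δ := by push_cast; nlinarith
    set p := (x (n + 1) - x n) / δ with hp
    set q := x n - p * (n * δ) with hq
    have hpδ : p * δ = x (n + 1) - x n := by rw [hp]; field_simp
    have hfg : h (n * δ) = (fun t => p * t + q) (n * δ) := by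
      simp only [hx n le_rfl, hq]; ring
    refine ⟨glue (n * δ) h (fun t => p * t + q), absolutelyContinuousOnInterval_glue hn hn1 hac
      (absolutelyContinuousOnInterval_affine _ _ _ _) hfg, fun k hk => ?_, fun k hk t ht => ?_, ?_⟩
    · rcases Nat.le_succ_iff.1 hk with hk | rfl
      · rw [glue_of_le _ _ (by gcongr), hx k hk]
      · rw [glue_of_ge hfg hn1, hq]
        push_cast
        linear_combination hpδ
    · rcases Nat.lt_succ_iff_lt_or_eq.1 hk with hk | rfl
      · rw [glue_of_le _ _ (ht.2.trans (by gcongr; exact hk))]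
        exact hu k hk t ht
      · rw [glue_of_ge hfg ht.1]
        have h1 := ht.1
        have h2 := ht.2
        push_cast at h2
        have e : p * t + q = x k + (t - k * δ) / δ * (x (k + 1) - x k) := by
          rw [hq, hp]; field_simp; ring
        have hs : (t - k * δ) / δ ∈ Icc (0 : ℝ) 1 :=
          ⟨by apply div_nonneg <;> linarith, by rw [div_le_one hδ]; linarith⟩
        rw [e, ← segment_eq_uIcc, segment_eq_image']
        exact ⟨_, hs, rfl⟩
    · rw [energy_glue hn hn1 hfg, he, energy_affine, Finset.sum_range_succ, add_div,
        ENNReal.ofReal_add (by positivity) (by positivity), ← ENNReal.ofReal_mul (sq_nonneg _)]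
      congr 2
      rw [hp]; push_cast; field_simp; ring

/-- Adding a linear function at most doubles the energy, up to the energy of the linear
function. -/
theorem energy_add_affine_le {f : ℝ → ℝ} {a b : ℝ} (hab : a ≤ b)
    (hf : AbsolutelyContinuousOnInterval f a b) (p q : ℝ) :
    energy a b (fun t => f t + (p * t + q)) ≤
      2 * energy a b f + 2 * (ENNReal.ofReal (p ^ 2) * ENNReal.ofReal (b - a)) := by
  have h1 : energy a b (fun t => f t + (p * t + q)) ≤
      ∫⁻ t in Icc a b, (2 * ENNReal.ofReal (deriv f t ^ 2) + 2 * ENNReal.ofReal (p ^ 2)) := by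
    refine lintegral_mono_ae ?_
    filter_upwards [ae_restrict_mem measurableSet_Icc,
      ae_restrict_of_ae hf.ae_differentiableAt] with t ht hd
    rw [uIcc_of_le hab] at hd
    have : deriv (fun t => f t + (p * t + q)) t = deriv f t + p := by
      rw [deriv_fun_add (hd ht) (by fun_prop)]
      simp
    rw [this, ← mul_add, ← ENNReal.ofReal_add (sq_nonneg _) (sq_nonneg _),
      ← ENNReal.ofReal_ofNat 2, ← ENNReal.ofReal_mul (by norm_num)]
    exact ENNReal.ofReal_le_ofReal (by nlinarith [sq_nonneg (deriv f t - p)])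
  refine h1.trans_eq ?_
  rw [lintegral_add_right _ (by fun_prop), lintegral_const_mul' _ _ (by simp)]
  simp [energy, mul_assoc]

/-! ### Minimal energy of a single path: concatenation, change of end condition, scaling -/

/-- The admissible functions, with fixed end if `b` holds. -/
def admissibleClass (b : Prop) (w : ℝ → ℝ) (T r : ℝ) : Set (ℝ → ℝ) :=
  {h | h ∈ admissible w T r ∧ (b → h T = w T)}

/-- The minimal energy over the admissible functions, with fixed end if `b` holds. -/
noncomputable def minEnergy (b : Prop) (w : ℝ → ℝ) (T r : ℝ) : ℝ≥0∞ :=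
  ⨅ h ∈ admissibleClass b w T r, energy 0 T h

/-- Squaring is an order isomorphism of `[0, ∞]`, so it commutes with infima. -/
theorem sq_iInf_sobolevNorm (S : Set (ℝ → ℝ)) (T : ℝ) :
    (⨅ h ∈ S, sobolevNorm T h) ^ 2 = ⨅ h ∈ S, energy 0 T h := by
  have := (ENNReal.orderIsoRpow 2 (by norm_num)).map_iInf₂ fun h (_ : h ∈ S) => sobolevNorm T h
  simp only [ENNReal.orderIsoRpow_apply, sobolevNorm, ← ENNReal.rpow_mul] at this
  rw [ENNReal.rpow_ofNat] at this
  simpa [sobolevNorm, energy] using this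

theorem I_sq (w : ℝ → ℝ) (T r : ℝ) : I w T r ^ 2 = minEnergy False w T r := by
  simp [I, minEnergy, admissibleClass, sq_iInf_sobolevNorm]

theorem IFixedEnd_sq (w : ℝ → ℝ) (T r : ℝ) : IFixedEnd w T r ^ 2 = minEnergy True w T r := by
  have : admissibleClass True w T r = admissibleFixedEnd w T r := by
    simp [admissibleClass, admissibleFixedEnd]
  rw [IFixedEnd, minEnergy, this, sq_iInf_sobolevNorm]

theorem biInf_lt_iff {ι : Type*} {S : Set ι} {f : ι → ℝ≥0∞} {a : ℝ≥0∞} :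
    (⨅ i ∈ S, f i) < a ↔ ∃ i ∈ S, f i < a := by
  simp [iInf_lt_iff]

theorem minEnergy_le {b : Prop} {w h : ℝ → ℝ} {T r : ℝ} (hh : h ∈ admissibleClass b w T r) :
    minEnergy b w T r ≤ energy 0 T h :=
  iInf₂_le h hh

theorem minEnergy_false_le_true (w : ℝ → ℝ) (T r : ℝ) :
    minEnergy False w T r ≤ minEnergy True w T r :=
  le_iInf₂ fun _ hh => minEnergy_le ⟨hh.1, False.elim⟩

theorem minEnergy_anti (b : Prop) (w : ℝ → ℝ) (T : ℝ) {r r' : ℝ} (h : r ≤ r') :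
    minEnergy b w T r' ≤ minEnergy b w T r :=
  le_iInf₂ fun _ hh => minEnergy_le ⟨⟨hh.1.1, fun t ht => (hh.1.2.1 t ht).trans h, hh.1.2.2⟩, hh.2⟩

theorem minEnergy_congr (b : Prop) {w w' : ℝ → ℝ} {T : ℝ} (r : ℝ) (hT : 0 ≤ T)
    (h : EqOn w w' (Icc 0 T)) : minEnergy b w T r = minEnergy b w' T r := by
  have : admissibleClass b w T r = admissibleClass b w' T r := by
    ext f
    simp only [admissibleClass, admissible, mem_ofPred_eq, h ⟨hT, le_rfl⟩]
    refine and_congr_left fun _ => and_congr_right fun _ => and_congr_left fun _ =>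
      forall₂_congr fun t ht => ?_
    rw [h ht]
  rw [minEnergy, this, minEnergy]

/-- Reduces a bound between minimal energies to one for each pair of competitors; multiplication by
`p` passes through the infimum since `p` is neither `0` nor `∞`. -/
theorem le_minEnergy_add_minEnergy {b b' : Prop} {w w' : ℝ → ℝ} {T T' r r' : ℝ} {c p q : ℝ≥0∞}
    (hp : p ≠ 0) (hp' : p ≠ ∞)
    (H : ∀ f ∈ admissibleClass b w T r, ∀ g ∈ admissibleClass b' w' T' r',
      c ≤ energy 0 T f + (p * energy 0 T' g + q)) :
    c ≤ minEnergy b w T r + (p * minEnergy b' w' T' r' + q) := by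
  simp only [minEnergy, ENNReal.mul_iInf_of_ne hp hp', ENNReal.iInf_add, ENNReal.add_iInf]
  exact le_iInf₂ fun f hf => le_iInf₂ fun g hg => H g hg f hf

/-- Translating the time of an absolutely continuous function. -/
theorem absolutelyContinuousOnInterval_comp_sub {f : ℝ → ℝ} {T : ℝ} (S : ℝ) (hT : 0 ≤ T)
    (hf : AbsolutelyContinuousOnInterval f 0 T) :
    AbsolutelyContinuousOnInterval (fun t => f (1 * t + -S)) S (S + T) := by
  refine hf.comp_monotone (φ := fun t => 1 * t + -S) (K := 1) (fun x y h => by simpa using h)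
    (LipschitzWith.of_dist_le_mul fun x y => by simp) fun x hx => ?_
  rw [uIcc_of_le (by linarith)] at hx
  rw [uIcc_of_le hT]
  exact ⟨by linarith [hx.1], by linarith [hx.2]⟩

/-- Subadditivity of the minimal energy with fixed end. -/
theorem minEnergy_add_le (w : ℝ → ℝ) {S T : ℝ} (r : ℝ) (hS : 0 ≤ S) (hT : 0 ≤ T) :
    minEnergy True w (S + T) r ≤
      minEnergy True w S r + minEnergy True (fun t => w (S + t) - w S) T r := by
  suffices h : minEnergy True w (S + T) r ≤ minEnergy True w S r +
      (1 * minEnergy True (fun t => w (S + t) - w S) T r + 0) by simpa using h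
  refine le_minEnergy_add_minEnergy one_ne_zero ENNReal.one_ne_top fun f hf g hg => ?_
  rw [one_mul, add_zero]
  have hST : S ≤ S + T := by linarith
  have hfg : f S = (fun t => g (1 * t + -S) + w S) S := by simp [hg.1.2.2, hf.2 trivial]
  have hac : AbsolutelyContinuousOnInterval (fun t => g (1 * t + -S) + w S) S (S + T) :=
    (absolutelyContinuousOnInterval_comp_sub S hT hg.1.1).fun_add
      ((LipschitzWith.const (w S)).lipschitzOnWith.absolutelyContinuousOnInterval)
  refine (minEnergy_le (h := glue S f (fun t => g (1 * t + -S) + w S))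
    ⟨⟨absolutelyContinuousOnInterval_glue hS hST hf.1.1 hac hfg, fun t ht => ?_, ?_⟩,
      fun _ => ?_⟩).trans_eq ?_
  · rcases le_total t S with h | h
    · rw [glue_of_le _ _ h]
      exact hf.1.2.1 t ⟨ht.1, h⟩
    · rw [glue_of_ge hfg h]
      have := hg.1.2.1 (1 * t + -S) ⟨by linarith, by linarith [ht.2]⟩
      convert this using 2
      ring_nf
  · rw [glue_of_le _ _ hS, hf.1.2.2]
  · rw [glue_of_ge hfg hST]
    have := hg.2 trivial
    simp [this]
  · rw [energy_glue hS hST hfg, energy_add_const, energy_comp_mul_add one_pos]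
    simp

/-- The free-end minimal energy controls the fixed-end one on a longer interval and for a larger
radius. -/
theorem minEnergy_true_le_false (w : ℝ → ℝ) {T r : ℝ} (δ : ℝ) (hT : 0 ≤ T) (hδ : 0 ≤ δ) :
    minEnergy True w (T + 1) (r + δ) ≤ minEnergy False w T r +
      (2 * minEnergy True (fun t => w (T + t) - w T) 1 δ + 2 * ENNReal.ofReal (r ^ 2)) := by
  refine le_minEnergy_add_minEnergy two_ne_zero ENNReal.ofNat_ne_top fun f hf g hg => ?_
  have hST : T ≤ T + 1 := by linarith
  set e := f T - w T with he
  have her : |e| ≤ r := hf.1.2.1 T ⟨hT, le_rfl⟩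
  -- `G t = g (t - T) + w T + e (T + 1 - t)`: it follows the increment of `w` after `T`, while the
  -- gap `e` left by `f` at `T` decays linearly to zero at `T + 1`.
  set G : ℝ → ℝ := fun t => g (1 * t + -T) + (-e * t + (w T + e * (T + 1))) with hG
  have hfg : f T = G T := by simp [hG, hg.1.2.2, he]; ring
  have hac1 := absolutelyContinuousOnInterval_comp_sub T zero_le_one hg.1.1
  have hac : AbsolutelyContinuousOnInterval G T (T + 1) :=
    hac1.fun_add (absolutelyContinuousOnInterval_affine _ _ _ _)
  refine (minEnergy_le (h := glue T f G)
    ⟨⟨absolutelyContinuousOnInterval_glue hT hST hf.1.1 hac hfg, fun t ht => ?_, ?_⟩,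
      fun _ => ?_⟩).trans ?_
  · rcases le_total t T with h | h
    · rw [glue_of_le _ _ h]
      exact (hf.1.2.1 t ⟨ht.1, h⟩).trans (by linarith)
    · rw [glue_of_ge hfg h]
      have h1 := hg.1.2.1 (1 * t + -T) ⟨by linarith, by linarith [ht.2]⟩
      simp only [show T + (1 * t + -T) = t by ring] at h1
      have h2 : |(T + 1 - t) * e| ≤ r := by
        rw [abs_mul, abs_of_nonneg (by linarith [ht.2])]
        exact (mul_le_of_le_one_left (abs_nonneg _) (by linarith)).trans her
      calc |G t - w t| = |(T + 1 - t) * e + (g (1 * t + -T) - (w t - w T))| := by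
            simp only [hG]; ring_nf
        _ ≤ r + δ := (abs_add_le _ _).trans (add_le_add h2 h1)
  · rw [glue_of_le _ _ hT, hf.1.2.2]
  · rw [glue_of_ge hfg hST]
    have := hg.2 trivial
    simp only [hG, show 1 * (T + 1) + -T = 1 by ring, this]
    ring
  · rw [energy_glue hT hST hfg]
    gcongr
    refine (energy_add_affine_le hST hac1 _ _).trans ?_
    rw [energy_comp_mul_add one_pos]
    have : ENNReal.ofReal ((-e) ^ 2) ≤ ENNReal.ofReal (r ^ 2) := by
      apply ENNReal.ofReal_le_ofReal
      rw [neg_sq]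
      exact sq_le_sq' (abs_le.1 her).1 (abs_le.1 her).2
    have h3 : T + 1 - T = 1 := by ring
    simp only [one_mul, ENNReal.ofReal_one, h3, add_neg_cancel, mul_one,
      show T + 1 + -T = 1 by ring]
    gcongr

theorem minEnergy_scale_le (b : Prop) (w : ℝ → ℝ) {a c T : ℝ} (r : ℝ) (hT : 0 ≤ T) (ha : 0 < a)
    (hc : 0 < c) (hac : a ^ 2 * c = 1) :
    minEnergy b (fun t => a * w (c * t)) T (a * r) ≤ minEnergy b w (c * T) r := by
  refine le_iInf₂ fun h hh => ?_
  refine (minEnergy_le (h := fun t => a * h (c * t + 0))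
    ⟨⟨?_, fun t ht => ?_, ?_⟩, fun hb => ?_⟩).trans_eq ?_
  · refine (hh.1.1.comp_monotone (φ := fun t => c * t + 0) (K := c.toNNReal)
      (fun x y h => by simp only [add_zero]; gcongr)
      (LipschitzWith.of_dist_le_mul fun x y => ?_) fun x hx => ?_).const_mul a
    · simp [Real.dist_eq, ← mul_sub, abs_mul, abs_of_pos hc, hc.le]
    · rw [uIcc_of_le hT] at hx
      rw [uIcc_of_le (by positivity)]
      exact ⟨by simpa using mul_nonneg hc.le hx.1, by simpa using by gcongr; exact hx.2⟩
  · simp only [add_zero]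
    rw [← mul_sub, abs_mul, abs_of_pos ha]
    gcongr
    exact hh.1.2.1 _ ⟨mul_nonneg hc.le ht.1, by gcongr; exact ht.2⟩
  · simp [hh.1.2.2]
  · simp [hh.2 hb]
  · rw [energy_const_mul, energy_comp_mul_add hc, ← mul_assoc,
      ← ENNReal.ofReal_mul (sq_nonneg _), hac]
    simp

/-- Brownian scaling of the minimal energy. -/
theorem minEnergy_scale (b : Prop) (w : ℝ → ℝ) {a c T : ℝ} (r : ℝ) (hT : 0 ≤ T) (ha : 0 < a)
    (hc : 0 < c) (hac : a ^ 2 * c = 1) :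
    minEnergy b (fun t => a * w (c * t)) T (a * r) = minEnergy b w (c * T) r := by
  refine le_antisymm (minEnergy_scale_le b w r hT ha hc hac) ?_
  have := minEnergy_scale_le b (fun t => a * w (c * t)) (a := a⁻¹) (c := c⁻¹) (T := c * T) (a * r)
    (by positivity) (by positivity) (by positivity) (by field_simp; linarith)
  have e1 : (fun t => a⁻¹ * (a * w (c * (c⁻¹ * t)))) = w := by ext t; field_simp
  have e2 : a⁻¹ * (a * r) = r := by field_simp
  have e3 : c⁻¹ * (c * T) = T := by field_simp
  rwa [e1, e2, e3] at this

/-! ### Discretization and measurability -/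

/-- The piecewise linear interpolation of suitable nodes is admissible. -/
theorem minEnergy_le_of_nodes {b : Prop} {w : ℝ → ℝ} {δ r : ℝ} (hδ : 0 < δ) {n : ℕ} (hn : n ≠ 0)
    {z : ℕ → ℝ} (h0 : z 0 = 0) (hz : ∀ k < n, ∀ t ∈ Icc (k * δ) ((k + 1 : ℕ) * δ),
      |z k - w t| ≤ r ∧ |z (k + 1) - w t| ≤ r) (hb : b → z n = w (n * δ)) :
    minEnergy b w (n * δ) r ≤
      ENNReal.ofReal ((∑ k ∈ Finset.range n, (z (k + 1) - z k) ^ 2) / δ) := by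
  obtain ⟨h, hac, hx, hu, he⟩ := exists_interpolation hδ n z
  rw [← he]
  refine minEnergy_le ⟨⟨hac, fun t ht => ?_, ?_⟩, fun hb' => ?_⟩
  · obtain ⟨k, hk, htk⟩ : ∃ k < n, t ∈ Icc (k * δ) ((k + 1 : ℕ) * δ) := by
      rcases ht.2.eq_or_lt with rfl | hlt
      · refine ⟨n - 1, by omega, ?_, ?_⟩
        · gcongr; omega
        · gcongr; omega
      · refine ⟨⌊t / δ⌋₊, ?_, ?_, ?_⟩
        · rw [Nat.floor_lt (div_nonneg ht.1 hδ.le), div_lt_iff₀ hδ]; exact hlt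
        · rw [← le_div_iff₀ hδ]; exact Nat.floor_le (div_nonneg ht.1 hδ.le)
        · rw [← div_le_iff₀ hδ]; push_cast; exact (Nat.lt_floor_add_one _).le
    have h1 := hu k hk t htk
    obtain ⟨h2, h3⟩ := hz k hk t htk
    rw [abs_le] at h2 h3 ⊢
    rw [mem_uIcc] at h1
    constructor <;> rcases h1 with h1 | h1 <;> linarith
  · have := hx 0 (Nat.zero_le n)
    simpa [h0] using this
  · rw [hx n le_rfl, hb hb']

/-- The nodes obtained from samples `y` of a function and errors `e`. -/
noncomputable def nodes (y e : ℕ → ℝ) (k : ℕ) : ℝ := if k = 0 then 0 else y k + e k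

/-- The minimal energy for the discretized problem. -/
noncomputable def discreteEnergy (b : Prop) (n : ℕ) (δ r : ℝ) (y : ℕ → ℝ) : ℝ≥0∞ :=
  ⨅ e ∈ {e : ℕ → ℝ | (∀ k, |e k| ≤ r) ∧ (b → e n = 0)},
    ENNReal.ofReal ((∑ k ∈ Finset.range n, (nodes y e (k + 1) - nodes y e k) ^ 2) / δ)

/-- Since the constraint is on the errors `e` and not on the nodes, the competitors do not depend on
`y`. An infimum of continuous functions of `y`, even an uncountable one, is upper semicontinuous. -/
theorem measurable_discreteEnergy (b : Prop) (n : ℕ) (δ r : ℝ) :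
    Measurable (discreteEnergy b n δ r) := by
  refine UpperSemicontinuous.measurable ?_
  unfold discreteEnergy
  refine upperSemicontinuous_biInf fun e _ => Continuous.upperSemicontinuous ?_
  refine ENNReal.continuous_ofReal.comp (Continuous.div_const ?_ δ)
  have : ∀ k, Continuous fun y : ℕ → ℝ => nodes y e k := by
    intro k
    unfold nodes
    split_ifs <;> fun_prop
  fun_prop

/-- Sampling a competitor on the grid does not increase its energy, by Cauchy–Schwarz on each cell.
-/
theorem discreteEnergy_le_minEnergy (b : Prop) (w : ℝ → ℝ) {n : ℕ} {δ r : ℝ} (hδ : 0 < δ)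
    (hr : 0 ≤ r) :
    discreteEnergy b n δ r (fun k => w (k * δ)) ≤ minEnergy b w (n * δ) r := by
  refine le_iInf₂ fun h hh => ?_
  refine le_trans ?_ (sum_ofReal_sq_sub_div_le_energy hδ n hh.1.1)
  -- The errors are cut off beyond `n`, where `h` need not be close to `w`, because the constraint
  -- concerns every `k`.
  have hmem : (fun k : ℕ => if k ≤ n then h (k * δ) - w (k * δ) else 0) ∈
      {e : ℕ → ℝ | (∀ k, |e k| ≤ r) ∧ (b → e n = 0)} := by
    refine ⟨fun k => ?_, fun hb => by simp [hh.2 hb]⟩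
    dsimp only
    split_ifs with hk
    · exact hh.1.2.1 _ ⟨by positivity, by gcongr⟩
    · simpa using hr
  refine (iInf₂_le _ hmem).trans_eq ?_
  · have hz : ∀ k ≤ n, nodes (fun k => w (k * δ))
        (fun k : ℕ => if k ≤ n then h (k * δ) - w (k * δ) else 0) k = h (k * δ) := by
      intro k hk
      rcases eq_or_ne k 0 with rfl | h0
      · simp [nodes, hh.1.2.2]
      · simp [nodes, h0, hk]
    congr 2
    refine Finset.sum_congr rfl fun k hk => ?_
    rw [Finset.mem_range] at hk
    rw [hz k hk.le, hz (k + 1) hk]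

/-- A continuous function oscillates little on the cells of fine grids. -/
theorem exists_grid_osc {w : ℝ → ℝ} (hw : Continuous w) {T ε : ℝ} (hT : 0 < T) (hε : 0 < ε) :
    ∃ n : ℕ, ∀ k < n + 1, ∀ t ∈ Icc (k * (T / (n + 1 : ℕ))) ((k + 1 : ℕ) * (T / (n + 1 : ℕ))),
      |w (k * (T / (n + 1 : ℕ))) - w t| ≤ ε ∧
        |w ((k + 1 : ℕ) * (T / (n + 1 : ℕ))) - w t| ≤ ε := by
  have huc := isCompact_Icc.uniformContinuousOn_of_continuous (hw.continuousOn (s := Icc 0 T))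
  obtain ⟨η, hη, H⟩ := Metric.uniformContinuousOn_iff.1 huc ε hε
  obtain ⟨n, hn⟩ := exists_nat_gt (T / η)
  refine ⟨n, fun k hk t ht => ?_⟩
  have hpos : (0 : ℝ) < (n + 1 : ℕ) := by positivity
  set δ := T / (n + 1 : ℕ) with hδ
  have hδ0 : 0 < δ := by positivity
  have hδη : δ < η := by
    rw [hδ, div_lt_iff₀ hpos, ← div_lt_iff₀' hη]
    push_cast; linarith
  have hTδ : (n + 1 : ℕ) * δ = T := by rw [hδ]; field_simp
  have hkT : (k + 1 : ℕ) * δ ≤ T := by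
    rw [← hTδ]; gcongr; omega
  have hk0 : 0 ≤ k * δ := by positivity
  have h1 := ht.1
  have h2 := ht.2
  have e : ((k + 1 : ℕ) : ℝ) * δ = k * δ + δ := by push_cast; ring
  rw [e] at hkT h2 ⊢
  have htT : t ∈ Icc 0 T := ⟨by linarith, by linarith⟩
  constructor
  · refine (H (k * δ) ⟨hk0, by linarith⟩ t htT ?_).le
    rw [Real.dist_eq, abs_lt]
    constructor <;> linarith
  · refine (H (k * δ + δ) ⟨by linarith, by linarith⟩ t htT ?_).le
    rw [Real.dist_eq, abs_lt]
    constructor <;> linarith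

/-- The interpolation of `w` itself on a fine grid is admissible. -/
theorem minEnergy_true_lt_top {w : ℝ → ℝ} (hw : Continuous w) (h0 : w 0 = 0) {T r : ℝ}
    (hT : 0 < T) (hr : 0 < r) : minEnergy True w T r < ∞ := by
  obtain ⟨n, hn⟩ := exists_grid_osc hw hT hr
  have hδ : 0 < T / (n + 1 : ℕ) := by positivity
  have := minEnergy_le_of_nodes (b := True) (w := w) (r := r) hδ n.succ_ne_zero
    (z := fun k => w (k * (T / (n + 1 : ℕ)))) (by simp [h0]) hn (fun _ => rfl)
  rw [show ((n.succ : ℕ) : ℝ) * (T / (n + 1 : ℕ)) = T by field_simp] at this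
  exact this.trans_lt ENNReal.ofReal_lt_top

/-- The minimal energy is determined by discretizations. -/
theorem minEnergy_eq_iSup (b : Prop) {w : ℝ → ℝ} (hw : Continuous w) (h0 : w 0 = 0) {T r : ℝ}
    (hT : 0 < T) (hr : 0 < r) :
    minEnergy b w T r = ⨆ n : ℕ, discreteEnergy b (n + 1) (T / (n + 1 : ℕ)) r
      (fun k => w (k * (T / (n + 1 : ℕ)))) := by
  have hTn : ∀ n : ℕ, ((n + 1 : ℕ) : ℝ) * (T / (n + 1 : ℕ)) = T := fun n => by field_simp
  refine le_antisymm ?_ (iSup_le fun n => ?_)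
  swap
  · have := discreteEnergy_le_minEnergy b w (n := n + 1) (δ := T / (n + 1 : ℕ)) (by positivity)
      hr.le
    rwa [hTn] at this
  refine le_of_forall_gt_imp_ge_of_dense fun c hc => ?_
  refine ENNReal.le_of_forall_pos_le_add fun ε' hε' hctop => ?_
  -- Interpolating discrete competitors may leave the tube between grid points. Mixing in a weight
  -- `ε` of a function `h` with radius `r / 2` gains the slack `ε * (r / 2)`, which absorbs the
  -- oscillation of `w` on a cell; the mixing adds at most `ε * A ≤ ε'` to the energy.
  obtain ⟨h, hh, hlt⟩ := biInf_lt_iff.1 (minEnergy_true_lt_top hw h0 hT (half_pos hr))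
  set A := (energy 0 T h).toReal with hA
  have hA0 : 0 ≤ A := ENNReal.toReal_nonneg
  set ε : ℝ := min 1 (ε' / (A + 1)) with hε
  have hε0 : 0 < ε := lt_min one_pos (div_pos (by exact_mod_cast hε') (by linarith))
  have hε1 : ε ≤ 1 := min_le_left _ _
  have hεA : ε * A ≤ ε' := by
    have : ε * (A + 1) ≤ ε' := (le_div_iff₀ (by linarith)).1 (min_le_right _ _)
    nlinarith
  obtain ⟨n, hn⟩ := exists_grid_osc hw hT (show 0 < ε * (r / 2) by positivity)
  have hcn := (le_iSup (fun n : ℕ => discreteEnergy b (n + 1) (T / (n + 1 : ℕ)) r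
      (fun k => w (k * (T / (n + 1 : ℕ))))) n).trans_lt hc
  have hδ : 0 < T / (n + 1 : ℕ) := by positivity
  have hTn' := hTn n
  simp only [discreteEnergy] at hcn
  set δ := T / (n + 1 : ℕ)
  obtain ⟨e, ⟨he, heb⟩, hec⟩ := biInf_lt_iff.1 hcn
  set z := nodes (fun k => w (k * δ)) e with hz
  have hz1 : ∀ k : ℕ, |z k - w (k * δ)| ≤ r := by
    intro k
    rcases eq_or_ne k 0 with rfl | hk
    · simp [hz, nodes, h0, hr.le]
    · simpa [hz, nodes, hk] using he k
  have hz2 : ∀ k ≤ n + 1, |h (k * δ) - w (k * δ)| ≤ r / 2 := fun k hk =>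
    hh.1.2.1 _ ⟨by positivity, by rw [← hTn']; gcongr⟩
  have hcomb : ∀ k ≤ n + 1, ∀ t, |w (k * δ) - w t| ≤ ε * (r / 2) →
      |((1 - ε) * z k + ε * h (k * δ)) - w t| ≤ r := by
    intro k hk t ht
    have h1 := abs_le.1 (hz1 k)
    have h2 := abs_le.1 (hz2 k hk)
    have h3 := abs_le.1 ht
    rw [abs_le]
    constructor <;> nlinarith [mul_le_mul_of_nonneg_left h1.1 (sub_nonneg.2 hε1),
      mul_le_mul_of_nonneg_left h1.2 (sub_nonneg.2 hε1),
      mul_le_mul_of_nonneg_left h2.1 hε0.le, mul_le_mul_of_nonneg_left h2.2 hε0.le]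
  have hmain := minEnergy_le_of_nodes (b := b) (w := w) (r := r) hδ n.succ_ne_zero
    (z := fun k => (1 - ε) * z k + ε * h (k * δ)) (by simp [hz, nodes, hh.1.2.2])
    (fun k hk t ht => ⟨hcomb k (by omega) t (hn k hk t ht).1,
      hcomb (k + 1) (by omega) t (hn k hk t ht).2⟩) (fun hb => ?_)
  swap
  · have h1 : z (n + 1) = w ((n + 1 : ℕ) * δ) := by simp [hz, nodes, heb hb]
    have h2 := hh.2 trivial
    simp only [Nat.succ_eq_add_one, h1, hTn', h2]
    ring
  rw [Nat.succ_eq_add_one, hTn'] at hmain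
  refine hmain.trans ?_
  set B := (∑ k ∈ Finset.range (n + 1), (h ((k + 1 : ℕ) * δ) - h (k * δ)) ^ 2) / δ with hB
  have hBA : B ≤ A := by
    rw [hA, ← ENNReal.ofReal_le_iff_le_toReal hlt.ne]
    have := sum_ofReal_sq_sub_div_le_energy hδ (n + 1) (h := h) (by rw [hTn']; exact hh.1.1)
    rwa [hTn'] at this
  calc _ ≤ ENNReal.ofReal ((∑ k ∈ Finset.range (n + 1), (z (k + 1) - z k) ^ 2) / δ + ε * B) := by
        apply ENNReal.ofReal_le_ofReal
        rw [hB, ← mul_div_assoc, ← add_div, Finset.mul_sum, ← Finset.sum_add_distrib]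
        gcongr with k hk
        -- Convexity of the square, with the weight `1 - ε` bounded by 1.
        have : ∀ p q : ℝ, ((1 - ε) * p + ε * q) ^ 2 ≤ p ^ 2 + ε * q ^ 2 := by
          intro p q
          nlinarith [mul_nonneg (mul_nonneg hε0.le (sub_nonneg.2 hε1)) (sq_nonneg (p - q)),
            mul_nonneg hε0.le (sq_nonneg p)]
        refine le_trans (le_of_eq ?_) (this _ _)
        ring
    _ ≤ ENNReal.ofReal ((∑ k ∈ Finset.range (n + 1), (z (k + 1) - z k) ^ 2) / δ) +
          ENNReal.ofReal (ε * B) := ENNReal.ofReal_add_le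
    _ ≤ c + ε' := by
        refine add_le_add hec.le (ENNReal.ofReal_le_of_le_toReal ?_)
        exact (mul_le_mul_of_nonneg_left hBA hε0.le).trans (by simpa using hεA)

/-! ### Brownian paths: invariance of the law, scaling and mean energies -/

theorem continuous_path {Ω : Type*} {W : ℝ≥0 → Ω → ℝ} {ω : Ω} (h : Continuous (W · ω)) :
    Continuous (path W ω) :=
  h.comp continuous_real_toNNReal

theorem path_shift_eq {Ω : Type*} {W : ℝ≥0 → Ω → ℝ} {S : ℝ} (hS : 0 ≤ S) {T : ℝ} (ω : Ω) :
    EqOn (fun t => path W ω (S + t) - path W ω S)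
      (path (fun t ω => W (S.toNNReal + t) ω - W S.toNNReal ω) ω) (Icc 0 T) := by
  intro t ht
  simp [path, Real.toNNReal_add hS ht.1]

section Law

variable {Ω Ω' : Type*} [MeasurableSpace Ω] [MeasurableSpace Ω'] {P : Measure Ω} {P' : Measure Ω'}
  {W : ℝ≥0 → Ω → ℝ} {W' : ℝ≥0 → Ω' → ℝ}

theorem aemeasurable_sample (hW : IsPreBrownianReal W P) {ι : Type*} [Countable ι] (u : ι → ℝ≥0) :
    AEMeasurable (fun ω i => W (u i) ω) P :=
  aemeasurable_pi_lambda _ fun i => hW.aemeasurable (u i)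

/-- Countably many values of a Brownian motion have a joint law that does not depend on the
Brownian motion. -/
theorem map_sample_eq (hW : IsPreBrownianReal W P) (hW' : IsPreBrownianReal W' P') {ι : Type*}
    [Countable ι] (u : ι → ℝ≥0) :
    P.map (fun ω i => W (u i) ω) = P'.map (fun ω i => W' (u i) ω) := by
  classical
  have := hW.isGaussianProcess.isProbabilityMeasure
  have := hW'.isGaussianProcess.isProbabilityMeasure
  have key : ∀ (J : Finset ι),
      P.map (fun ω => J.restrict fun i => W (u i) ω) =
        P'.map (fun ω => J.restrict fun i => W' (u i) ω) := by
    intro J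
    -- `u` may repeat values, so the finite-dimensional law lives on the image of `J` and is pulled
    -- back by `φ`.
    let φ : (↥(J.image u) → ℝ) → (J → ℝ) :=
      fun x j => x ⟨u j, Finset.mem_image_of_mem u j.2⟩
    have hφ : Measurable φ := measurable_pi_lambda _ fun j => measurable_pi_apply _
    have h1 := hW.hasLaw (J.image u)
    have h2 := hW'.hasLaw (J.image u)
    have e1 := AEMeasurable.map_map_of_aemeasurable hφ.aemeasurable h1.aemeasurable
    have e2 := AEMeasurable.map_map_of_aemeasurable hφ.aemeasurable h2.aemeasurable
    rw [h1.map_eq] at e1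
    rw [h2.map_eq] at e2
    exact e1.symm.trans e2
  have l1 := isProjectiveLimit_map (P := P) (X := fun i => W (u i)) (aemeasurable_sample hW u)
  have l2 := isProjectiveLimit_map (P := P') (X := fun i => W' (u i)) (aemeasurable_sample hW' u)
  simp_rw [← key] at l2
  exact l1.unique l2

/-- The grid points used to discretize the minimal energy on `[0, T]`. -/
noncomputable def gridPoint (T : ℝ) (i : ℕ × ℕ) : ℝ≥0 := (i.2 * (T / (i.1 + 1 : ℕ))).toNNReal

/-- The minimal energy as a functional of the values at the grid points. -/
noncomputable def sampledEnergy (b : Prop) (T r : ℝ) (y : ℕ × ℕ → ℝ) : ℝ≥0∞ :=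
  ⨆ n : ℕ, discreteEnergy b (n + 1) (T / (n + 1 : ℕ)) r (fun k => y (n, k))

theorem measurable_sampledEnergy (b : Prop) (T r : ℝ) : Measurable (sampledEnergy b T r) :=
  Measurable.iSup fun _ => (measurable_discreteEnergy b _ _ _).comp
    (measurable_pi_lambda _ fun _ => measurable_pi_apply _)

theorem ae_path (hW : IsBrownianReal W P) :
    ∀ᵐ ω ∂P, Continuous (path W ω) ∧ path W ω 0 = 0 := by
  filter_upwards [hW.cont, hW.eval_zero_ae_eq_zero] with ω h1 h2
  exact ⟨continuous_path h1, by simpa [path] using h2⟩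

theorem minEnergy_ae_eq (b : Prop) (hW : IsBrownianReal W P) {T r : ℝ} (hT : 0 < T) (hr : 0 < r) :
    (fun ω => minEnergy b (path W ω) T r) =ᵐ[P]
      fun ω => sampledEnergy b T r (fun i => W (gridPoint T i) ω) := by
  filter_upwards [ae_path hW] with ω hω
  exact minEnergy_eq_iSup b hω.1 hω.2 hT hr

theorem aemeasurable_minEnergy (b : Prop) (hW : IsBrownianReal W P) {T r : ℝ} (hT : 0 < T)
    (hr : 0 < r) : AEMeasurable (fun ω => minEnergy b (path W ω) T r) P :=
  ((measurable_sampledEnergy b T r).comp_aemeasurable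
    (aemeasurable_sample hW.toIsPreBrownianReal (gridPoint T))).congr
      (minEnergy_ae_eq b hW hT hr).symm

/-- The expected minimal energy. -/
noncomputable def meanEnergy (b : Prop) (P : Measure Ω) (W : ℝ≥0 → Ω → ℝ) (T r : ℝ) : ℝ≥0∞ :=
  ∫⁻ ω, minEnergy b (path W ω) T r ∂P

/-- The expected minimal energy is the same for all Brownian motions. -/
theorem meanEnergy_eq (b : Prop) (hW : IsBrownianReal W P) (hW' : IsBrownianReal W' P') {T r : ℝ}
    (hT : 0 < T) (hr : 0 < r) : meanEnergy b P W T r = meanEnergy b P' W' T r := by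
  have h1 := aemeasurable_sample hW.toIsPreBrownianReal (gridPoint T)
  have h2 := aemeasurable_sample hW'.toIsPreBrownianReal (gridPoint T)
  rw [meanEnergy, meanEnergy, lintegral_congr_ae (minEnergy_ae_eq b hW hT hr),
    lintegral_congr_ae (minEnergy_ae_eq b hW' hT hr),
    ← lintegral_map' (measurable_sampledEnergy b T r).aemeasurable h1,
    ← lintegral_map' (measurable_sampledEnergy b T r).aemeasurable h2,
    map_sample_eq hW.toIsPreBrownianReal hW'.toIsPreBrownianReal]

/-- `W (c t) / √c` is again a Brownian motion, and the mean energy does not depend on which one is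
used. -/
theorem meanEnergy_scale (b : Prop) (hW : IsBrownianReal W P) {c T r : ℝ} (hc : 0 < c) (hT : 0 < T)
    (hr : 0 < r) : meanEnergy b P W (c * T) r = meanEnergy b P W T (r / √c) := by
  have hc' : c.toNNReal ≠ 0 := by simpa using hc
  rw [meanEnergy_eq b hW (hW.smul hc') hT (by positivity)]
  refine lintegral_congr fun ω => ?_
  have ha : 0 < (√c)⁻¹ := by positivity
  rw [← minEnergy_scale b (path W ω) r hT.le ha hc
    (by rw [inv_pow, Real.sq_sqrt hc.le, inv_mul_cancel₀ hc.ne'])]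
  rw [div_eq_inv_mul]
  refine minEnergy_congr b _ hT.le fun t ht => ?_
  simp [path, Real.toNNReal_mul hc.le, hc.le]

theorem lintegral_minEnergy_shift (b : Prop) (hW : IsBrownianReal W P) {S T r : ℝ} (hS : 0 ≤ S)
    (hT : 0 < T) (hr : 0 < r) :
    ∫⁻ ω, minEnergy b (fun t => path W ω (S + t) - path W ω S) T r ∂P = meanEnergy b P W T r := by
  rw [meanEnergy_eq b hW (hW.shift S.toNNReal) hT hr]
  exact lintegral_congr fun ω => minEnergy_congr b r hT.le (path_shift_eq hS ω)

theorem aemeasurable_minEnergy_shift (b : Prop) (hW : IsBrownianReal W P) {S T r : ℝ} (hS : 0 ≤ S)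
    (hT : 0 < T) (hr : 0 < r) :
    AEMeasurable (fun ω => minEnergy b (fun t => path W ω (S + t) - path W ω S) T r) P :=
  (aemeasurable_minEnergy b (hW.shift S.toNNReal) hT hr).congr
    (Eventually.of_forall fun ω => (minEnergy_congr b r hT.le (path_shift_eq hS ω)).symm)

/-- The mean of the concatenation bound; only stationarity of increments enters, not independence.
-/
theorem meanEnergy_add_le (hW : IsBrownianReal W P) {S T r : ℝ} (hS : 0 ≤ S) (hT : 0 < T)
    (hr : 0 < r) :
    meanEnergy True P W (S + T) r ≤ meanEnergy True P W S r + meanEnergy True P W T r := by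
  rw [← lintegral_minEnergy_shift True hW hS hT hr, meanEnergy, meanEnergy,
    ← lintegral_add_right' _ (aemeasurable_minEnergy_shift True hW hS hT hr)]
  exact lintegral_mono fun ω => minEnergy_add_le _ r hS hT.le

/-- The bracketed cost does not depend on `T`, so it disappears after division by `T`. -/
theorem meanEnergy_true_le_false (hW : IsBrownianReal W P) {T r δ : ℝ} (hT : 0 ≤ T) (hδ : 0 < δ) :
    meanEnergy True P W (T + 1) (r + δ) ≤ meanEnergy False P W T r +
      (2 * meanEnergy True P W 1 δ + 2 * ENNReal.ofReal (r ^ 2)) := by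
  have := hW.isGaussianProcess.isProbabilityMeasure
  have hm := aemeasurable_minEnergy_shift True hW hT one_pos hδ
  have e : 2 * meanEnergy True P W 1 δ + 2 * ENNReal.ofReal (r ^ 2) =
      ∫⁻ ω, (2 * minEnergy True (fun t => path W ω (T + t) - path W ω T) 1 δ +
        2 * ENNReal.ofReal (r ^ 2)) ∂P := by
    rw [lintegral_add_right _ measurable_const, lintegral_const_mul' _ _ ENNReal.ofNat_ne_top,
      lintegral_minEnergy_shift True hW hT one_pos hδ]
    simp
  rw [e, meanEnergy, meanEnergy, ← lintegral_add_right' _ ((hm.const_mul 2).add_const _)]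
  exact lintegral_mono fun ω => minEnergy_true_le_false _ δ hT hδ.le

theorem meanEnergy_false_le_true (P : Measure Ω) (W : ℝ≥0 → Ω → ℝ) (T r : ℝ) :
    meanEnergy False P W T r ≤ meanEnergy True P W T r :=
  lintegral_mono fun _ => minEnergy_false_le_true _ _ _

theorem meanEnergy_anti (b : Prop) (P : Measure Ω) (W : ℝ≥0 → Ω → ℝ) (T : ℝ) {r r' : ℝ}
    (h : r ≤ r') : meanEnergy b P W T r' ≤ meanEnergy b P W T r :=
  lintegral_mono fun _ => minEnergy_anti b _ T h

end Law

/-! ### Finiteness of the mean energy via dyadic increments -/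

section SecondMoment

/-- A weighted sum of eighth powers of dyadic increments. -/
noncomputable def dyadicSum (w : ℝ → ℝ) : ℝ≥0∞ :=
  ∑' n : ℕ, ∑ k ∈ Finset.range (2 ^ n),
    ENNReal.ofReal ((5 / 4) ^ (8 * n) * (w ((k + 1 : ℕ) * (1 / 2 ^ n)) - w (k * (1 / 2 ^ n))) ^ 8)

/-- A bound on the dyadic increments gives a bound for the distance to dyadic approximations. -/
theorem abs_sub_dyadic_le {w : ℝ → ℝ} (hw : Continuous w) {K : ℝ}
    (hK : ∀ n : ℕ, ∀ k < 2 ^ n,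
      |w ((k + 1 : ℕ) * (1 / 2 ^ n)) - w (k * (1 / 2 ^ n))| ≤ K * (4 / 5) ^ n)
    (n : ℕ) {t : ℝ} (ht : t ∈ Ico (0 : ℝ) 1) :
    |w (⌊t * 2 ^ n⌋₊ * (1 / 2 ^ n)) - w t| ≤ 4 * K * (4 / 5) ^ n := by
  have hK0 : 0 ≤ K := by
    have := (abs_nonneg _).trans (hK 0 0 (by norm_num))
    simpa using this
  set f : ℕ → ℝ := fun j => w (⌊t * 2 ^ j⌋₊ * (1 / 2 ^ j)) with hf
  have hstep : ∀ j, dist (f j) (f (j + 1)) ≤ (K * (4 / 5)) * (4 / 5) ^ j := by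
    intro j
    -- From level `j + 1` to level `j` the index is halved, so consecutive approximations agree or
    -- differ by one increment of level `j + 1`. Summing the geometric series gives the factor `4 =
    -- (4/5) / (1 - 4/5)`.
    have hdiv : ⌊t * 2 ^ j⌋₊ = ⌊t * 2 ^ (j + 1)⌋₊ / 2 := by
      rw [← Nat.floor_div_ofNat]
      congr 1
      rw [pow_succ]; ring
    set m := ⌊t * 2 ^ (j + 1)⌋₊ with hm
    have hlt : m < 2 ^ (j + 1) := by
      rw [hm, Nat.floor_lt (mul_nonneg ht.1 (by positivity))]
      push_cast
      exact mul_lt_of_lt_one_left (by positivity) ht.2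
    have e : (⌊t * 2 ^ j⌋₊ : ℝ) * (1 / 2 ^ j) = ((2 * (m / 2) : ℕ) : ℝ) * (1 / 2 ^ (j + 1)) := by
      rw [hdiv]
      push_cast
      rw [pow_succ]; field_simp
    have hcase : m = 2 * (m / 2) ∨ m = 2 * (m / 2) + 1 := by omega
    simp only [hf, e, ← hm]
    rcases hcase with h | h
    · rw [← h, dist_self]
      positivity
    · have := hK (j + 1) (2 * (m / 2)) (by omega)
      rw [← h, abs_sub_comm] at this
      rw [Real.dist_eq]
      refine this.trans_eq ?_
      rw [pow_succ]; ring
  have hlim : Tendsto f atTop (𝓝 (w t)) := by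
    refine (hw.tendsto t).comp ?_
    have := (tendsto_nat_floor_mul_div_atTop (R := ℝ) ht.1).comp
      (tendsto_pow_atTop_atTop_of_one_lt (one_lt_two (α := ℝ)))
    refine this.congr fun j => ?_
    simp [Function.comp, div_eq_mul_inv]
  have := dist_le_of_le_geometric_of_tendsto (4 / 5) (K * (4 / 5)) (by norm_num) hstep hlim n
  rw [Real.dist_eq] at this
  refine this.trans_eq ?_
  ring

/-- The minimal energy is bounded in terms of the dyadic increments. -/
theorem minEnergy_le_dyadicSum {w : ℝ → ℝ} (hw : Continuous w) (h0 : w 0 = 0) {r : ℝ} (hr : 0 < r) :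
    minEnergy True w 1 r ≤ ENNReal.ofReal (r ^ 2) +
      ENNReal.ofReal (4 * (5 / r) ^ 8 * r ^ 2) * dyadicSum w := by
  by_cases htop : dyadicSum w = ∞
  · rw [htop, ENNReal.mul_top (by simpa using by positivity)]
    simp
  set S := (dyadicSum w).toReal with hS
  have hS0 : 0 ≤ S := ENNReal.toReal_nonneg
  set K := S ^ (1 / 8 : ℝ) with hKdef
  have hK0 : 0 ≤ K := by positivity
  have hK8 : K ^ 8 = S := by
    rw [hKdef, ← Real.rpow_natCast, ← Real.rpow_mul hS0]
    norm_num
  have hK : ∀ n : ℕ, ∀ k < 2 ^ n,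
      |w ((k + 1 : ℕ) * (1 / 2 ^ n)) - w (k * (1 / 2 ^ n))| ≤ K * (4 / 5) ^ n := by
    intro n k hk
    set x := w ((k + 1 : ℕ) * (1 / 2 ^ n)) - w (k * (1 / 2 ^ n)) with hx
    have h1 : ENNReal.ofReal ((5 / 4) ^ (8 * n) * x ^ 8) ≤ dyadicSum w :=
      (Finset.single_le_sum (f := fun k : ℕ => ENNReal.ofReal ((5 / 4) ^ (8 * n) *
        (w ((k + 1 : ℕ) * (1 / 2 ^ n)) - w (k * (1 / 2 ^ n))) ^ 8)) (fun _ _ => zero_le)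
        (Finset.mem_range.2 hk)).trans (ENNReal.le_tsum n)
    have h2 : (5 / 4) ^ (8 * n) * x ^ 8 ≤ K ^ 8 := by
      rw [hK8]
      exact (ENNReal.ofReal_le_iff_le_toReal htop).1 h1
    have h3 : |x| ^ 8 ≤ (K * (4 / 5) ^ n) ^ 8 := by
      have e : (5 / 4 : ℝ) ^ (8 * n) * (4 / 5) ^ (8 * n) = 1 := by
        rw [← mul_pow]; norm_num
      have e8 : |x| ^ 8 = x ^ 8 := by
        rw [show 8 = 2 * 4 by rfl, pow_mul, sq_abs, pow_mul]
      rw [mul_pow, ← pow_mul, mul_comm n 8, e8]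
      calc x ^ 8 = ((5 / 4) ^ (8 * n) * x ^ 8) * (4 / 5) ^ (8 * n) := by
            linear_combination (- x ^ 8) * e
        _ ≤ _ := by gcongr
    exact le_of_pow_le_pow_left₀ (by norm_num) (by positivity) h3
  -- Here `5 = 4 + 1`: the left node of a cell is within `4 K (4/5)^n` of the path, and the right
  -- node is one increment further. The least such `n` is used.
  have hex : ∃ n : ℕ, 5 * K * (4 / 5) ^ n ≤ r := by
    have : Tendsto (fun n : ℕ => 5 * K * (4 / 5 : ℝ) ^ n) atTop (𝓝 (5 * K * 0)) :=
      (tendsto_pow_atTop_nhds_zero_of_lt_one (by norm_num) (by norm_num)).const_mul _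
    rw [mul_zero] at this
    exact ((this.eventually (gt_mem_nhds hr)).exists).imp fun n h => le_of_lt h
  classical
  obtain ⟨n, hn, hmin⟩ : ∃ n : ℕ, 5 * K * (4 / 5) ^ n ≤ r ∧ ∀ m < n, r < 5 * K * (4 / 5) ^ m :=
    ⟨Nat.find hex, Nat.find_spec hex, fun m hm => not_le.1 (Nat.find_min hex hm)⟩
  have hδ : (0 : ℝ) < 1 / 2 ^ n := by positivity
  have hmain := minEnergy_le_of_nodes (b := True) (w := w) (r := r) hδ (n := 2 ^ n) (by positivity)
    (z := fun k => w (k * (1 / 2 ^ n))) (by simp [h0]) (fun k hk t ht => ?_) (fun _ => rfl)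
  swap
  · have h1 := hK n k hk
    have hq : 0 ≤ K * (4 / 5) ^ n := by positivity
    -- The right endpoint is separate because its dyadic floor is `k + 1`, not `k`.
    rcases ht.2.eq_or_lt with rfl | hlt
    · rw [abs_sub_comm]
      exact ⟨h1.trans (by linarith), by simpa using hr.le⟩
    · have hk1 : ((k + 1 : ℕ) : ℝ) * (1 / 2 ^ n) ≤ 1 := by
        rw [mul_one_div, div_le_one (by positivity)]
        exact_mod_cast hk
      have h2 := abs_sub_dyadic_le hw hK n (t := t)
        ⟨le_trans (by positivity) ht.1, hlt.trans_le hk1⟩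
      have hfl : ⌊t * 2 ^ n⌋₊ = k := by
        rw [Nat.floor_eq_iff (mul_nonneg (le_trans (by positivity) ht.1) (by positivity))]
        have h3 := ht.1
        rw [mul_one_div] at h3 hlt
        rw [div_le_iff₀ (by positivity)] at h3
        rw [lt_div_iff₀ (by positivity)] at hlt
        exact ⟨h3, by exact_mod_cast hlt⟩
      rw [hfl] at h2
      refine ⟨h2.trans (by linarith), (abs_sub_le _ (w (k * (1 / 2 ^ n))) _).trans ?_⟩
      linarith
  rw [show ((2 ^ n : ℕ) : ℝ) * (1 / 2 ^ n) = 1 by push_cast; field_simp] at hmain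
  refine hmain.trans ?_
  rw [← ENNReal.ofReal_toReal htop, ← hS, ← ENNReal.ofReal_mul (by positivity),
    ← ENNReal.ofReal_add (by positivity) (by positivity)]
  apply ENNReal.ofReal_le_ofReal
  have hsum : (∑ k ∈ Finset.range (2 ^ n),
      (w ((k + 1 : ℕ) * (1 / 2 ^ n)) - w (k * (1 / 2 ^ n))) ^ 2) / (1 / 2 ^ n) ≤ 4 ^ n * r ^ 2 := by
    have h1 : ∀ k ∈ Finset.range (2 ^ n),
        (w ((k + 1 : ℕ) * (1 / 2 ^ n)) - w (k * (1 / 2 ^ n))) ^ 2 ≤ r ^ 2 := by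
      intro k hk
      have h2 := hK n k (Finset.mem_range.1 hk)
      have hq : 0 ≤ K * (4 / 5) ^ n := by positivity
      have h3 := abs_le.1 (h2.trans (show K * (4 / 5) ^ n ≤ r by linarith))
      exact sq_le_sq' h3.1 h3.2
    have h2 := Finset.sum_le_card_nsmul _ _ _ h1
    rw [Finset.card_range, nsmul_eq_mul] at h2
    rw [div_div_eq_mul_div, div_one]
    calc _ ≤ ((2 ^ n : ℕ) : ℝ) * r ^ 2 * 2 ^ n := by gcongr
      _ = 4 ^ n * r ^ 2 := by
        rw [show (4 : ℝ) = 2 * 2 by norm_num, mul_pow]; push_cast; ring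
  refine hsum.trans ?_
  -- At `n = 0` the term `r²` suffices. Otherwise minimality of `n` fails the bound at `m`, which
  -- bounds `(5/4)^m` by a multiple of `K`; then `4 ≤ (5/4)^8` bounds `4^m` by a multiple of `K^8 =
  -- S`.
  rcases n with _ | m
  · have : 0 ≤ 4 * (5 / r) ^ 8 * r ^ 2 * S := by positivity
    simpa using this
  · have h1 := hmin m m.lt_succ_self
    have h2 : (5 / 4 : ℝ) ^ m ≤ 5 / r * K := by
      have e : (5 / 4 : ℝ) ^ m * (4 / 5) ^ m = 1 := by
        rw [← mul_pow]; norm_num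
      rw [div_mul_eq_mul_div, le_div_iff₀ hr]
      calc (5 / 4 : ℝ) ^ m * r ≤ (5 / 4 : ℝ) ^ m * (5 * K * (4 / 5) ^ m) := by gcongr
        _ = 5 * K := by linear_combination (5 * K) * e
    have h3 : (4 : ℝ) ^ m ≤ (5 / r) ^ 8 * S := by
      rw [← hK8, ← mul_pow]
      calc (4 : ℝ) ^ m ≤ ((5 / 4 : ℝ) ^ 8) ^ m := by gcongr; norm_num
        _ = ((5 / 4 : ℝ) ^ m) ^ 8 := by rw [← pow_mul, ← pow_mul, mul_comm]
        _ ≤ _ := by gcongr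
    rw [pow_succ]
    nlinarith [sq_nonneg r, mul_le_mul_of_nonneg_right h3 (sq_nonneg r)]

theorem lintegral_pow_eight_gaussianReal (v : ℝ≥0) :
    ∫⁻ x, ENNReal.ofReal (x ^ 8) ∂gaussianReal 0 v =
      ENNReal.ofReal (v ^ 4) * ∫⁻ x, ENNReal.ofReal (x ^ 8) ∂gaussianReal 0 1 := by
  have h := gaussianReal_map_const_mul (μ := 0) (v := 1) (√v)
  have hv : NNReal.mk (√(v : ℝ) ^ 2) (sq_nonneg _) * 1 = v := by
    ext; simp
  rw [mul_zero, hv] at h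
  rw [← h, lintegral_map (by fun_prop) (by fun_prop), ← lintegral_const_mul' _ _
    ENNReal.ofReal_ne_top]
  refine lintegral_congr fun x => ?_
  rw [mul_pow, ENNReal.ofReal_mul (by positivity)]
  congr 2
  rw [show 8 = 2 * 4 by rfl, pow_mul, Real.sq_sqrt v.coe_nonneg]

theorem lintegral_pow_eight_gaussianReal_lt_top :
    ∫⁻ x, ENNReal.ofReal (x ^ 8) ∂gaussianReal 0 1 < ∞ := by
  have h := (memLp_id_gaussianReal (μ := 0) (v := 1) 8).integrable_norm_pow (p := 8) (by norm_num)
  have h2 := h.2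
  rw [hasFiniteIntegral_iff_ofReal (Eventually.of_forall fun _ => by positivity)] at h2
  refine lt_of_le_of_lt (lintegral_mono fun x => ?_) h2
  apply ENNReal.ofReal_le_ofReal
  rw [id, ← norm_pow]
  exact le_abs_self _

variable {Ω : Type*} [MeasurableSpace Ω] {P : Measure Ω} {W : ℝ≥0 → Ω → ℝ}

theorem lintegral_dyadicSum_lt_top (hW : IsPreBrownianReal W P) :
    ∫⁻ ω, dyadicSum (path W ω) ∂P < ∞ := by
  set c := ∫⁻ x, ENNReal.ofReal (x ^ 8) ∂gaussianReal 0 1 with hc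
  have hm : ∀ n k : ℕ, AEMeasurable (fun ω => ENNReal.ofReal ((5 / 4) ^ (8 * n) *
      (path W ω ((k + 1 : ℕ) * (1 / 2 ^ n)) - path W ω (k * (1 / 2 ^ n))) ^ 8)) P := fun n k =>
    ((((hW.aemeasurable _).sub (hW.aemeasurable _)).pow_const 8).const_mul _).ennreal_ofReal
  have hterm : ∀ n k : ℕ, ∫⁻ ω, ENNReal.ofReal ((5 / 4) ^ (8 * n) *
      (path W ω ((k + 1 : ℕ) * (1 / 2 ^ n)) - path W ω (k * (1 / 2 ^ n))) ^ 8) ∂P =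
      ENNReal.ofReal ((5 / 4) ^ (8 * n) * (1 / 2 ^ n) ^ 4) * c := by
    intro n k
    simp_rw [ENNReal.ofReal_mul (show (0 : ℝ) ≤ (5 / 4) ^ (8 * n) by positivity)]
    rw [lintegral_const_mul' _ _ ENNReal.ofReal_ne_top, mul_assoc]
    congr 1
    have hl := hW.hasLaw_sub ((k + 1 : ℕ) * (1 / 2 ^ n) : ℝ).toNNReal (k * (1 / 2 ^ n) : ℝ).toNNReal
    have h2 := hl.lintegral_comp (f := fun x => ENNReal.ofReal (x ^ 8)) (by fun_prop)
    refine (h2.trans (lintegral_pow_eight_gaussianReal _)).trans ?_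
    congr 3
    rw [coe_nndist, Real.dist_eq]
    rw [show ((((k + 1 : ℕ) * (1 / 2 ^ n) : ℝ).toNNReal).1 : ℝ) = (k + 1 : ℕ) * (1 / 2 ^ n) from
      Real.coe_toNNReal _ (by positivity),
      show (((k * (1 / 2 ^ n) : ℝ).toNNReal).1 : ℝ) = k * (1 / 2 ^ n) from
      Real.coe_toNNReal _ (by positivity), ← sub_mul]
    push_cast
    rw [add_sub_cancel_left, one_mul, abs_of_nonneg (by positivity)]
  unfold dyadicSum
  rw [lintegral_tsum fun n => Finset.aemeasurable_fun_sum _ fun k _ => hm n k]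
  -- Level `n` has `2^n` increments of variance `2^{-n}`, each with eighth moment `2^{-4n} c`. The
  -- resulting geometric series converges since `(5/4)^8 < 8`.
  have : ∀ n : ℕ, ∫⁻ ω, ∑ k ∈ Finset.range (2 ^ n), ENNReal.ofReal ((5 / 4) ^ (8 * n) *
      (path W ω ((k + 1 : ℕ) * (1 / 2 ^ n)) - path W ω (k * (1 / 2 ^ n))) ^ 8) ∂P =
      ENNReal.ofReal ((5 / 4) ^ 8 / 8) ^ n * c := by
    intro n
    rw [lintegral_finsetSum' _ fun k _ => hm n k]
    simp_rw [hterm]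
    rw [Finset.sum_const, Finset.card_range, nsmul_eq_mul, ← mul_assoc]
    congr 1
    rw [← ENNReal.ofReal_natCast, ← ENNReal.ofReal_mul (by positivity),
      ← ENNReal.ofReal_pow (by positivity)]
    congr 1
    push_cast
    rw [div_pow ((5 / 4 : ℝ) ^ 8), ← pow_mul, show (8 : ℝ) = 2 ^ 3 by norm_num, ← pow_mul]
    field_simp
    ring
  simp_rw [this]
  rw [ENNReal.tsum_mul_right, ENNReal.tsum_geometric]
  refine ENNReal.mul_lt_top (ENNReal.inv_lt_top.2 ?_) lintegral_pow_eight_gaussianReal_lt_top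
  rw [tsub_pos_iff_lt, ← ENNReal.ofReal_one, ENNReal.ofReal_lt_ofReal_iff one_pos]
  norm_num

theorem meanEnergy_true_lt_top (hW : IsBrownianReal W P) {T r : ℝ} (hT : 0 < T) (hr : 0 < r) :
    meanEnergy True P W T r < ∞ := by
  have := hW.isGaussianProcess.isProbabilityMeasure
  rw [← mul_one T, meanEnergy_scale True hW hT one_pos hr]
  have hr' : 0 < r / √T := by positivity
  set ρ := r / √T
  refine lt_of_le_of_lt (lintegral_mono_ae (g := fun ω => ENNReal.ofReal (ρ ^ 2) +
      ENNReal.ofReal (4 * (5 / ρ) ^ 8 * ρ ^ 2) * dyadicSum (path W ω)) ?_) ?_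
  · filter_upwards [ae_path hW] with ω hω
    exact minEnergy_le_dyadicSum hω.1 hω.2 hr'
  · rw [lintegral_add_left measurable_const, lintegral_const_mul' _ _ ENNReal.ofReal_ne_top]
    exact ENNReal.add_lt_top.2 ⟨by simp, ENNReal.mul_lt_top ENNReal.ofReal_lt_top
      (lintegral_dyadicSum_lt_top hW.toIsPreBrownianReal)⟩

end SecondMoment

/-! ### Linear growth and the limit -/

section Limit

variable {Ω : Type*} [MeasurableSpace Ω] {P : Measure Ω} {W : ℝ≥0 → Ω → ℝ}

theorem toReal_meanEnergy_add_le (hW : IsBrownianReal W P) {S T : ℝ} (hS : 0 < S) (hT : 0 < T) :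
    (meanEnergy True P W (S + T) 1).toReal ≤
      (meanEnergy True P W S 1).toReal + (meanEnergy True P W T 1).toReal := by
  rw [← ENNReal.toReal_add (meanEnergy_true_lt_top hW hS one_pos).ne
    (meanEnergy_true_lt_top hW hT one_pos).ne]
  exact ENNReal.toReal_mono (ENNReal.add_ne_top.2 ⟨(meanEnergy_true_lt_top hW hS one_pos).ne,
    (meanEnergy_true_lt_top hW hT one_pos).ne⟩) (meanEnergy_add_le hW hS.le hT one_pos)

theorem subadditive_meanEnergy (hW : IsBrownianReal W P) :
    Subadditive fun n : ℕ => (meanEnergy True P W n 1).toReal := by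
  intro m n
  rcases m.eq_zero_or_pos with rfl | hm
  · simp
  rcases n.eq_zero_or_pos with rfl | hn
  · simp
  push_cast
  exact toReal_meanEnergy_add_le hW (by exact_mod_cast hm) (by exact_mod_cast hn)

/-- The expected minimal energy with fixed end is bounded on `[1, 2]`. -/
theorem toReal_meanEnergy_le_of_mem_Icc (hW : IsBrownianReal W P) {s : ℝ} (hs : s ∈ Icc (1 : ℝ) 2) :
    (meanEnergy True P W s 1).toReal ≤ (meanEnergy True P W 1 (1 / √2)).toReal := by
  have hs0 : 0 < s := by linarith [hs.1]
  refine ENNReal.toReal_mono (meanEnergy_true_lt_top hW one_pos (by positivity)).ne ?_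
  rw [← mul_one s, meanEnergy_scale True hW hs0 one_pos one_pos]
  refine meanEnergy_anti _ _ _ _ ?_
  gcongr
  exact hs.2

/-- The expected minimal energy with fixed end grows linearly. -/
theorem exists_linear_growth (hW : IsBrownianReal W P) :
    ∃ L M : ℝ, 0 ≤ L ∧ (∀ τ > 0, L * τ - M ≤ (meanEnergy True P W τ 1).toReal) ∧
      Tendsto (fun τ => (meanEnergy True P W τ 1).toReal / τ) atTop (𝓝 L) := by
  set u : ℝ → ℝ := fun τ => (meanEnergy True P W τ 1).toReal with hu
  have hu0 : ∀ τ, 0 ≤ u τ := fun τ => ENNReal.toReal_nonneg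
  set M := (meanEnergy True P W 1 (1 / √2)).toReal
  have hsub : Subadditive fun n : ℕ => u n := subadditive_meanEnergy hW
  have hbdd : BddBelow (range fun n : ℕ => u n / n) :=
    ⟨0, by rintro _ ⟨n, rfl⟩; exact div_nonneg (hu0 _) n.cast_nonneg⟩
  have hlim := hsub.tendsto_lim hbdd
  set L := hsub.lim
  have hL0 : 0 ≤ L := ge_of_tendsto' hlim fun n => div_nonneg (hu0 _) n.cast_nonneg
  have hlow : ∀ τ > 0, L * τ - M ≤ u τ := by
    intro τ hτ
    -- Rounding up this far puts `n - τ` in `[1, 2]`, so `L n ≤ u n ≤ u τ + M`.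
    set n := ⌊τ⌋₊ + 2 with hn
    have hn' : (n : ℝ) = ⌊τ⌋₊ + 2 := by rw [hn]; push_cast; ring
    have h1 := Nat.floor_le hτ.le
    have h2 := Nat.lt_floor_add_one τ
    have h3 : L ≤ u n / n := hsub.lim_le_div hbdd (by omega)
    rw [le_div_iff₀ (by rw [hn']; positivity)] at h3
    have h4 := toReal_meanEnergy_add_le hW hτ (T := n - τ) (by linarith)
    rw [add_sub_cancel] at h4
    have h5 := toReal_meanEnergy_le_of_mem_Icc hW (s := n - τ)
      ⟨by linarith, by linarith⟩
    have h6 : L * τ ≤ L * n := mul_le_mul_of_nonneg_left (by linarith) hL0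
    simp only [hu] at h3 ⊢
    linarith
  refine ⟨L, M, hL0, hlow, tendsto_order.2 ⟨fun l hl => ?_, fun l hl => ?_⟩⟩
  · have h1 : Tendsto (fun τ : ℝ => L - M / τ) atTop (𝓝 (L - 0)) :=
      tendsto_const_nhds.sub (tendsto_const_nhds.div_atTop tendsto_id)
    rw [sub_zero] at h1
    filter_upwards [h1.eventually (lt_mem_nhds hl), eventually_gt_atTop 0] with τ h2 hτ
    refine h2.trans_le ?_
    rw [le_div_iff₀ hτ, sub_mul, div_mul_cancel₀ _ hτ.ne']
    exact hlow τ hτ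
  · obtain ⟨l', hl', hl'2⟩ := exists_between hl
    have h1 : Tendsto (fun τ : ℝ => l' + M / τ) atTop (𝓝 (l' + 0)) :=
      tendsto_const_nhds.add (tendsto_const_nhds.div_atTop tendsto_id)
    rw [add_zero] at h1
    -- For the upper bound rounding goes down: `τ - ⌊τ - 1⌋₊` lies in `[1, 2]`, so the remainder
    -- costs at most `M`.
    have h2 : ∀ᶠ τ : ℝ in atTop, u (⌊τ - 1⌋₊ : ℕ) / (⌊τ - 1⌋₊ : ℕ) < l' :=
      (tendsto_nat_floor_atTop.comp (tendsto_atTop_add_const_right atTop (-1) tendsto_id)).eventually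
        (hlim.eventually (gt_mem_nhds hl'))
    filter_upwards [h1.eventually (gt_mem_nhds hl'2), h2, eventually_ge_atTop 2] with τ h3 h4 hτ
    have h0 : 0 ≤ τ - 1 := by linarith
    set n := ⌊τ - 1⌋₊ with hn
    have hn1 : 1 ≤ n := Nat.le_floor (by push_cast; linarith)
    have hn1' : (1 : ℝ) ≤ n := by exact_mod_cast hn1
    have h5 := Nat.floor_le h0
    have h6 := Nat.lt_floor_add_one (τ - 1)
    rw [← hn] at h5 h6
    rw [div_lt_iff₀ (by linarith)] at h4
    have h7 := toReal_meanEnergy_add_le hW (S := n) (T := τ - n) (by linarith) (by linarith)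
    rw [add_sub_cancel] at h7
    have h8 := toReal_meanEnergy_le_of_mem_Icc hW (s := τ - n) ⟨by linarith, by linarith⟩
    have hl'0 : 0 ≤ l' := hL0.trans hl'.le
    refine lt_of_le_of_lt ?_ h3
    rw [div_le_iff₀ (by linarith), add_mul, div_mul_cancel₀ _ (by linarith)]
    have h9 : l' * n ≤ l' * τ := mul_le_mul_of_nonneg_left (by linarith) hl'0
    simp only [hu] at h4
    linarith

theorem meanEnergy_false_lt_top (hW : IsBrownianReal W P) {T r : ℝ} (hT : 0 < T) (hr : 0 < r) :
    meanEnergy False P W T r < ∞ :=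
  (meanEnergy_false_le_true P W T r).trans_lt (meanEnergy_true_lt_top hW hT hr)

/-- The expected minimal energies with free and with fixed end have the same linear growth. -/
theorem exists_tendsto_meanEnergy (hW : IsBrownianReal W P) :
    ∃ L : ℝ, 0 ≤ L ∧ ∀ b, Tendsto (fun τ => (meanEnergy b P W τ 1).toReal / τ) atTop (𝓝 L) := by
  obtain ⟨L, M, hL, hlow, hlim⟩ := exists_linear_growth hW
  refine ⟨L, hL, fun b => ?_⟩
  by_cases hb : b
  · rwa [eq_true hb]
  rw [eq_false hb]
  refine tendsto_order.2 ⟨fun l hl => ?_, fun l hl => ?_⟩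
  swap
  · filter_upwards [hlim.eventually (gt_mem_nhds hl), eventually_gt_atTop 0] with τ h1 hτ
    refine lt_of_le_of_lt ?_ h1
    gcongr
    · exact (meanEnergy_true_lt_top hW hτ one_pos).ne
    · exact meanEnergy_false_le_true _ _ _ _
  obtain ⟨δ, hδL, hδ⟩ : ∃ δ : ℝ, l < L / (1 + δ) ^ 2 ∧ 0 < δ := by
    have h1 : Tendsto (fun δ : ℝ => L / (1 + δ) ^ 2) (𝓝[>] 0) (𝓝 (L / (1 + 0) ^ 2)) := by
      refine tendsto_nhdsWithin_of_tendsto_nhds ?_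
      refine ContinuousAt.tendsto (f := fun δ : ℝ => L / (1 + δ) ^ 2) ?_
      exact continuousAt_const.div (by fun_prop) (by norm_num)
    rw [add_zero, one_pow, div_one] at h1
    exact ((h1.eventually (lt_mem_nhds hl)).and self_mem_nhdsWithin).exists
  set A := (meanEnergy True P W 1 δ).toReal
  have hkey : ∀ τ > 0, L / (1 + δ) ^ 2 * τ - (M + 2 * A + 2) ≤
      (meanEnergy False P W τ 1).toReal := by
    intro τ hτ
    have h1 := meanEnergy_true_le_false hW (r := 1) hτ.le hδ
    have hA := (meanEnergy_true_lt_top hW one_pos hδ).ne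
    have hF := (meanEnergy_false_lt_top hW hτ one_pos).ne
    have h2 : 2 * meanEnergy True P W 1 δ + 2 * ENNReal.ofReal (1 ^ 2) ≠ ∞ :=
      ENNReal.add_ne_top.2 ⟨ENNReal.mul_ne_top ENNReal.ofNat_ne_top hA, by simp⟩
    have h3 := ENNReal.toReal_mono (ENNReal.add_ne_top.2 ⟨hF, h2⟩) h1
    rw [ENNReal.toReal_add hF h2, ENNReal.toReal_add
      (ENNReal.mul_ne_top ENNReal.ofNat_ne_top hA) (by simp)] at h3
    simp only [ENNReal.toReal_mul, ENNReal.toReal_ofNat, one_pow, ENNReal.ofReal_one,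
      mul_one] at h3
    -- Radius `1 + δ` is scaled back to 1, which shortens time by `(1 + δ)²`.
    have hs : 0 < (1 + δ) ^ 2 := by positivity
    have h4 : meanEnergy True P W (τ + 1) (1 + δ) =
        meanEnergy True P W ((τ + 1) / (1 + δ) ^ 2) 1 := by
      have := meanEnergy_scale True hW (c := (1 + δ) ^ 2) (T := (τ + 1) / (1 + δ) ^ 2)
        (r := 1 + δ) hs (by positivity) (by positivity)
      rw [Real.sqrt_sq (by positivity), div_self (by positivity)] at this
      rw [← this]
      congr 1
      field_simp
    rw [h4] at h3
    have h5 := hlow ((τ + 1) / (1 + δ) ^ 2) (by positivity)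
    have h6 : L / (1 + δ) ^ 2 * τ ≤ L * ((τ + 1) / (1 + δ) ^ 2) := by
      rw [div_mul_eq_mul_div, mul_div_assoc]
      gcongr
      linarith
    linarith
  have h1 : Tendsto (fun τ : ℝ => L / (1 + δ) ^ 2 - (M + 2 * A + 2) / τ) atTop
      (𝓝 (L / (1 + δ) ^ 2 - 0)) :=
    tendsto_const_nhds.sub (tendsto_const_nhds.div_atTop tendsto_id)
  rw [sub_zero] at h1
  filter_upwards [h1.eventually (lt_mem_nhds hδL), eventually_gt_atTop 0] with τ h2 hτ
  refine h2.trans_le ?_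
  rw [le_div_iff₀ hτ, sub_mul, div_mul_cancel₀ _ hτ.ne']
  exact hkey τ hτ

theorem tendsto_div_sq_ratioToZero :
    Tendsto (fun p : ℝ × ℝ => p.1 / p.2 ^ 2) ratioToZero atTop := by
  have h0 : Tendsto (fun p : ℝ × ℝ => p.2 / √p.1) ratioToZero (𝓝[>] 0) := by
    refine tendsto_nhdsWithin_iff.2 ⟨tendsto_comap.mono_left inf_le_left, ?_⟩
    refine mem_inf_of_right (mem_principal.2 fun p hp => ?_)
    exact div_pos hp.2 (Real.sqrt_pos.2 hp.1)
  have h1 := (tendsto_pow_atTop two_ne_zero).comp (tendsto_inv_nhdsGT_zero.comp h0)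
  refine h1.congr' ?_
  refine mem_inf_of_right (mem_principal.2 fun p hp => ?_)
  simp only [Function.comp, mem_ofPred_eq, inv_div, div_pow, Real.sq_sqrt hp.1.le]

/-- By scaling, the normalized mean at `(T, r)` is the mean at radius 1 and time `τ = T / r²`,
divided by `τ`. -/
theorem tendsto_ratioToZero (hW : IsBrownianReal W P) {b : Prop} {L : ℝ}
    (h : Tendsto (fun τ => (meanEnergy b P W τ 1).toReal / τ) atTop (𝓝 L)) :
    Tendsto (fun p : ℝ × ℝ => ENNReal.ofReal (p.2 ^ 2 / p.1) * meanEnergy b P W p.1 p.2)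
      ratioToZero (𝓝 (ENNReal.ofReal L)) := by
  refine (ENNReal.tendsto_ofReal (h.comp tendsto_div_sq_ratioToZero)).congr' ?_
  refine mem_inf_of_right (mem_principal.2 fun p hp => ?_)
  have hT := hp.1
  have hr := hp.2
  have hr2 : 0 < p.2 ^ 2 := by positivity
  have hτ : 0 < p.1 / p.2 ^ 2 := by positivity
  have hsc := meanEnergy_scale b hW (c := p.2 ^ 2) (T := p.1 / p.2 ^ 2) hr2 hτ hr
  rw [Real.sqrt_sq hr.le, div_self hr.ne', mul_div_cancel₀ _ hr2.ne'] at hsc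
  have hfin : meanEnergy b P W (p.1 / p.2 ^ 2) 1 ≠ ∞ := by
    by_cases hb : b
    · rw [eq_true hb]; exact (meanEnergy_true_lt_top hW hτ one_pos).ne
    · rw [eq_false hb]; exact (meanEnergy_false_lt_top hW hτ one_pos).ne
  simp only [mem_ofPred_eq, Function.comp_apply]
  rw [hsc, div_eq_inv_mul, inv_div,
    ENNReal.ofReal_mul (by positivity), ENNReal.ofReal_toReal hfin]

theorem D_eq (P : Measure Ω) (W : ℝ≥0 → Ω → ℝ) (T r : ℝ) : D P W T r = meanEnergy False P W T r :=
  lintegral_congr fun _ => I_sq _ _ _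

theorem DFixedEnd_eq (P : Measure Ω) (W : ℝ≥0 → Ω → ℝ) (T r : ℝ) :
    DFixedEnd P W T r = meanEnergy True P W T r :=
  lintegral_congr fun _ => IFixedEnd_sq _ _ _

theorem aemeasurable_of_sq {f : Ω → ℝ≥0∞} (hf : AEMeasurable (fun ω => f ω ^ 2) P) :
    AEMeasurable f P := by
  refine (hf.pow_const (1 / 2 : ℝ)).congr (Eventually.of_forall fun ω => ?_)
  dsimp only
  rw [← ENNReal.rpow_natCast, ← ENNReal.rpow_mul]
  norm_num

end Limit

/-! ### A common constant and the conclusion -/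

/-- The linear growth rate is the same for all Brownian motions. -/
theorem exists_tendsto_meanEnergy_uniform :
    ∃ L : ℝ, 0 ≤ L ∧ ∀ (Ω : Type*) [MeasurableSpace Ω] (P : Measure Ω)
      (W : ℝ≥0 → Ω → ℝ), IsBrownianReal W P →
      ∀ b, Tendsto (fun τ => (meanEnergy b P W τ 1).toReal / τ) atTop (𝓝 L) := by
  by_cases hex : ∃ (Ω : Type _) (_ : MeasurableSpace Ω) (P : Measure Ω) (W : ℝ≥0 → Ω → ℝ),
      IsBrownianReal W P
  · obtain ⟨Ω, _, P, W, hW⟩ := hex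
    obtain ⟨L, hL, h⟩ := exists_tendsto_meanEnergy hW
    refine ⟨L, hL, fun Ω' _ P' W' hW' b => (h b).congr' ?_⟩
    filter_upwards [eventually_gt_atTop 0] with τ hτ
    rw [meanEnergy_eq b hW hW' hτ one_pos]
  -- Without any Brownian motion the claim is vacuous, so none has to be constructed.
  · exact ⟨0, le_rfl, fun Ω _ P W hW => (hex ⟨Ω, _, P, W, hW⟩).elim⟩


end TautString

theorem mainTheorem3 :
    ∃ C : ℝ≥0, ∀ (Ω : Type*) [MeasurableSpace Ω] (P : Measure Ω) (W : ℝ≥0 → Ω → ℝ),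
      IsBrownianReal W P →
        (∀ T r : ℝ, 0 < T → 0 < r →
          AEMeasurable (fun ω => TautString.I (TautString.path W ω) T r) P ∧
          AEMeasurable (fun ω => TautString.IFixedEnd (TautString.path W ω) T r) P ∧
          TautString.D P W T r < ∞ ∧ TautString.DFixedEnd P W T r < ∞) ∧
        Tendsto (fun p : ℝ × ℝ => ENNReal.ofReal (p.2 ^ 2 / p.1) * TautString.D P W p.1 p.2)
          TautString.ratioToZero (𝓝 ((C : ℝ≥0∞) ^ 2)) ∧
        Tendsto
          (fun p : ℝ × ℝ => ENNReal.ofReal (p.2 ^ 2 / p.1) * TautString.DFixedEnd P W p.1 p.2)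
          TautString.ratioToZero (𝓝 ((C : ℝ≥0∞) ^ 2)) := by
  obtain ⟨L, hL, H⟩ := TautString.exists_tendsto_meanEnergy_uniform
  have hC : ((NNReal.sqrt L.toNNReal : ℝ≥0) : ℝ≥0∞) ^ 2 = ENNReal.ofReal L := by
    rw [← ENNReal.coe_pow, NNReal.sq_sqrt]
    rfl
  refine ⟨NNReal.sqrt L.toNNReal, fun Ω _ P W hW => ⟨fun T r hT hr => ⟨?_, ?_, ?_, ?_⟩, ?_, ?_⟩⟩
  · exact TautString.aemeasurable_of_sq
      (by simpa only [TautString.I_sq] using TautString.aemeasurable_minEnergy False hW hT hr)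
  · exact TautString.aemeasurable_of_sq
      (by simpa only [TautString.IFixedEnd_sq] using TautString.aemeasurable_minEnergy True hW hT hr)
  · rw [TautString.D_eq]; exact TautString.meanEnergy_false_lt_top hW hT hr
  · rw [TautString.DFixedEnd_eq]; exact TautString.meanEnergy_true_lt_top hW hT hr
  · simp only [TautString.D_eq, hC]
    exact TautString.tendsto_ratioToZero hW (H Ω P W hW False)
  · simp only [TautString.DFixedEnd_eq, hC]
    exact TautString.tendsto_ratioToZero hW (H Ω P W hW True)
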